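/- Let $\Omega=(a,b)\subset\mathbb R$ be a bounded open interval, let $n\in(0,3)$, and let $u_{in}\in H^1(\Omega)$ be non-negative. For $\varepsilon\in(0,1)$ let $u^\varepsilon\ge 0$ be a weak solution in $L^\infty((0,T');H^1(\Omega))$ (for every $T'<\infty$) of the thin film equation $$|\ln\varepsilon|^{-1}\partial_t u+\partial_x\big((\varepsilon^{3-n}u^n+u^3)\,\partial_{xxx}u\big)=0\quad\text{in }(0,\infty)\times\Omega,$$ with null flux and $u_x=0$ on $(0,\infty)\times\partial\Omega$ (where $u^\varepsilon(t,\cdot)\in C^1(\overline\Omega)$ for a.e. $t>0$), with $u(0,\cdot)=u_{in}$, and with $u^\varepsilon u^\varepsilon_{xxx}\in L^2((0,T')\times\Omega)$ for every $T'<\infty$. Set $$B(s)=\int_0^s\int_r^\infty\frac{dv\,dr}{v^{n-1}+v^2},\qquad B^\varepsilon(s)=\frac{B(s/\varepsilon)}{|\ln\varepsilon|},\qquad \rho^\varepsilon=B^\varepsilon(u^\varepsilon).$$ The solution $u^\varepsilon$ is assumed to satisfy the following a priori properties, where products with $u^\varepsilon_{xx}$ or $u^\varepsilon_{xxx}$ are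 understood to vanish where $u^\varepsilon=0$. For all $t>0$, $$\int_\Omega u^\varepsilon(t)\,dx=\int_\Omega u_{in}\,dx,$$ $$\int_\Omega\tfrac12|u^\varepsilon_x(t)|^2dx+\int_0^t\!\int_{\{u^\varepsilon>0\}}|\ln\varepsilon|\big(\varepsilon^{3-n}(u^\varepsilon)^n+(u^\varepsilon)^3\big)|u^\varepsilon_{xxx}|^2\,dx\,ds\le\int_\Omega\tfrac12|u_{in}'|^2dx,$$ $$\int_\Omega\rho^\varepsilon(t)\,dx\ge\int_0^t\!\int_\Omega u^\varepsilon|u^\varepsilon_{xx}|^2\,dx\,ds+\int_\Omega B^\varepsilon(u_{in})\,dx;$$ moreover $\partial_t\rho^\varepsilon=T^\varepsilon+\partial_xR^\varepsilon$ in the sense of distributions in $(0,\infty)\times\Omega$, where $$T^\varepsilon=-u^\varepsilon u^\varepsilon_xu^\varepsilon_{xxx},\qquad R^\varepsilon=-|\ln\varepsilon|\,(B^{\varepsilon})'(u^\varepsilon)\big(\varepsilon^{3-n}(u^\varepsilon)^{n-1}+(u^\varepsilon)^2\big)u^\varepsilon u^\varepsilon_{xxx},$$ and for a.e. $t>0$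 and every $\varphi\in C^\infty(\overline\Omega)$ $$\int_\Omega T^\varepsilon\varphi\,dx=\int_\Omega u^\varepsilon(u^\varepsilon_{xx})^2\varphi\,dx-\tfrac56\int_\Omega (u^\varepsilon_x)^3\varphi'\,dx-\tfrac12\int_\Omega u^\varepsilon (u^\varepsilon_x)^2\varphi''\,dx .$$ Let $T\in(0,\infty]$ and $p\in[1,\infty)$, and let the function $\rho(t,x)$ be an accumulation point of $\{\rho^\varepsilon\}$ as $\varepsilon\to0$: for some sequence $\varepsilon_k\to0$ one has $\rho^{\varepsilon_k}\to\rho$ strongly in $L^p(0,T';W^{-1,1}(\Omega))$ for every finite $T'\le T$ (with $\rho$ integrable on $(0,T')\times\Omega$). For a.e. $t\in(0,T)$ the function $\rho(t,\cdot)$ is well defined; for such $t$ let $$\Sigma(t)=\Big\{x\in\Omega:\ \exists r>0,\ \int_{B_r(x)\cap\Omega}[1-\rho(t,y)]\,dy=0\Big\},$$ which is the complement in $\Omega$ of the support of the measure $1-\rho(t,\cdot)$. Then $\Sigma$ is non-decreasing: there is a Lebesgue-null set $N$ of times such that $\Sigma(s)\subset\Sigma(t)$ whenever $0<s<t<T$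 and $s,t\notin N$. -/

import Mathlib

open MeasureTheory Filter Topology
open scoped ContDiff ENNReal

namespace ThinFilm

noncomputable section

/-- `φ` is a smooth function whose support is a compact subset of `U`. -/
def IsTestFunction {E : Type*} [NormedAddCommGroup E] [NormedSpace ℝ E]
    (U : Set E) (φ : E → ℝ) : Prop :=
  ContDiff ℝ ∞ φ ∧ HasCompactSupport φ ∧ tsupport φ ⊆ U

/-- `g` is the weak derivative of `f` on the open set `U ⊆ ℝ`. -/
def HasWeakDerivOn (U : Set ℝ) (f g : ℝ → ℝ) : Prop :=
  LocallyIntegrableOn f U ∧ LocallyIntegrableOn g U ∧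
    ∀ φ : ℝ → ℝ, IsTestFunction U φ →
      ∫ x in U, f x * deriv φ x = - ∫ x in U, g x * φ x

/-- The norm of `W^{-1,1}(a,b)` on integrable functions: the infimum of
`‖g₀‖_{L¹} + ‖g₁‖_{L¹}` over all decompositions `f = g₀ + ∂ₓ g₁` in the sense of
distributions on `(a,b)`, with `g₀` and `g₁` in `L¹(a,b)`. -/
def negSobolevNorm (a b : ℝ) (f : ℝ → ℝ) : ℝ≥0∞ :=
  ⨅ (g₀ : ℝ → ℝ) (g₁ : ℝ → ℝ)
    (_ : IntegrableOn f (Set.Ioo a b) ∧ IntegrableOn g₀ (Set.Ioo a b) ∧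
      IntegrableOn g₁ (Set.Ioo a b) ∧
      ∀ φ : ℝ → ℝ, IsTestFunction (Set.Ioo a b) φ →
        ∫ x in Set.Ioo a b, f x * φ x =
          (∫ x in Set.Ioo a b, g₀ x * φ x) - ∫ x in Set.Ioo a b, g₁ x * deriv φ x),
    (∫⁻ x in Set.Ioo a b, ‖g₀ x‖ₑ) + ∫⁻ x in Set.Ioo a b, ‖g₁ x‖ₑ

/-- `B(s) = ∫₀ˢ ∫ᵣ^∞ 1 / (v^{n-1} + v²) dv dr`. -/
def B (n s : ℝ) : ℝ :=
  ∫ r in (0 : ℝ)..s, ∫ v in Set.Ioi r, 1 / (v ^ (n - 1) + v ^ 2)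

/-- `B^ε(s) = B(s/ε) / |ln ε|`. -/
def Beps (n ε s : ℝ) : ℝ := B n (s / ε) / |Real.log ε|

/-- The mobility `ε^{3-n} u^n + u³`. -/
def mobility (n ε u : ℝ) : ℝ := ε ^ (3 - n) * u ^ n + u ^ 3

/-- A non-negative weak solution on `(0,∞) × (a,b)` of
`|ln ε|⁻¹ ∂ₜu + ∂ₓ((ε^{3-n} u^n + u³) ∂ₓₓₓu) = 0`, with null flux and `∂ₓu = 0` at `a` and `b`,
and with initial datum `uin`. The functions `ux`, `uxx`, `uxxx` are the weak space derivatives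
of `u`; those of order two and three are taken in the open set `{u(t,·) > 0}`, and everywhere
below they are multiplied by a factor that vanishes where `u` does. -/
structure WeakSolution (n a b : ℝ) (uin : ℝ → ℝ) (ε : ℝ) where
  /-- the height `u(t,x)` of the film -/
  u : ℝ → ℝ → ℝ
  /-- the derivative `∂ₓu` -/
  ux : ℝ → ℝ → ℝ
  /-- the derivative `∂ₓₓu` -/
  uxx : ℝ → ℝ → ℝ
  /-- the derivative `∂ₓₓₓu` -/
  uxxx : ℝ → ℝ → ℝ
  measurable_u : Measurable (Function.uncurry u)
  measurable_ux : Measurable (Function.uncurry ux)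
  measurable_uxx : Measurable (Function.uncurry uxx)
  measurable_uxxx : Measurable (Function.uncurry uxxx)
  /-- `u(t,·)` is the continuous representative -/
  continuousOn_u : ∀ t, 0 < t → ContinuousOn (u t) (Set.Icc a b)
  nonneg : ∀ t, 0 < t → ∀ x ∈ Set.Icc a b, 0 ≤ u t x
  weakDeriv_u : ∀ t, 0 < t → HasWeakDerivOn (Set.Ioo a b) (u t) (ux t)
  /-- `u` is in `L^∞(0,T; H¹)` for every `T` -/
  bounded_H1 : ∀ T : ℝ, ∃ C : ℝ, ∀ t, 0 < t → t < T →
    ∫⁻ x in Set.Ioo a b, ENNReal.ofReal (u t x ^ 2 + ux t x ^ 2) ≤ ENNReal.ofReal C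
  /-- for almost every `t`, `u(t,·)` is `C¹` up to the boundary and `∂ₓu` vanishes there -/
  boundary : ∀ᵐ t ∂volume.restrict (Set.Ioi (0 : ℝ)),
    ContinuousOn (ux t) (Set.Icc a b) ∧ ux t a = 0 ∧ ux t b = 0
  weakDeriv_ux : ∀ᵐ t ∂volume.restrict (Set.Ioi (0 : ℝ)),
    HasWeakDerivOn {x | x ∈ Set.Ioo a b ∧ 0 < u t x} (ux t) (uxx t)
  weakDeriv_uxx : ∀ᵐ t ∂volume.restrict (Set.Ioi (0 : ℝ)),
    HasWeakDerivOn {x | x ∈ Set.Ioo a b ∧ 0 < u t x} (uxx t) (uxxx t)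
  /-- `u ∂ₓₓₓu` is in `L²((0,T) × (a,b))` for every `T` -/
  memLp_u_uxxx : ∀ T : ℝ, MemLp (fun z : ℝ × ℝ => u z.1 z.2 * uxxx z.1 z.2) 2
    (volume.restrict (Set.Ioo 0 T ×ˢ Set.Ioo a b))
  /-- the equation with its initial condition; the test functions need not vanish at `a`, at `b`
  or at time `0`, which encodes the null flux condition and the initial condition -/
  equation : ∀ ψ : ℝ × ℝ → ℝ, IsTestFunction Set.univ ψ →
    |Real.log ε|⁻¹ * ((∫ t in Set.Ioi (0 : ℝ), ∫ x in Set.Ioo a b,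
          u t x * deriv (fun τ => ψ (τ, x)) t) + ∫ x in Set.Ioo a b, uin x * ψ (0, x)) +
      (∫ t in Set.Ioi (0 : ℝ), ∫ x in Set.Ioo a b,
        mobility n ε (u t x) * uxxx t x * deriv (fun y => ψ (t, y)) x) = 0

namespace WeakSolution

variable {n a b : ℝ} {uin : ℝ → ℝ} {ε : ℝ}

/-- `ρ^ε = B^ε(u^ε)`. -/
def rho (S : WeakSolution n a b uin ε) (t x : ℝ) : ℝ := Beps n ε (S.u t x)

/-- `T^ε = - u ∂ₓu ∂ₓₓₓu`. -/
def T (S : WeakSolution n a b uin ε) (t x : ℝ) : ℝ := - (S.u t x * S.ux t x * S.uxxx t x)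

/-- `R^ε = - |ln ε| (B^ε)'(u) (ε^{3-n} u^{n-1} + u²) u ∂ₓₓₓu`. -/
def R (S : WeakSolution n a b uin ε) (t x : ℝ) : ℝ :=
  - (|Real.log ε| * deriv (Beps n ε) (S.u t x) *
      (ε ^ (3 - n) * S.u t x ^ (n - 1) + S.u t x ^ 2) * S.u t x * S.uxxx t x)

end WeakSolution

/-- A weak solution that satisfies conservation of mass, the energy inequality, the entropy
inequality, and the equation `∂ₜρ^ε = T^ε + ∂ₓR^ε` with `T^ε` given by its weak formula.
Here `uin'` is the weak derivative of `uin`. -/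
structure Solution (n a b : ℝ) (uin uin' : ℝ → ℝ) (ε : ℝ) extends WeakSolution n a b uin ε where
  mass : ∀ t, 0 < t → ∫ x in Set.Ioo a b, u t x = ∫ x in Set.Ioo a b, uin x
  energy : ∀ t, 0 < t →
    (∫⁻ x in Set.Ioo a b, ENNReal.ofReal (1 / 2 * ux t x ^ 2)) +
      (∫⁻ s in Set.Ioo 0 t, ∫⁻ x in {x | x ∈ Set.Ioo a b ∧ 0 < u s x},
        ENNReal.ofReal (|Real.log ε| * mobility n ε (u s x) * uxxx s x ^ 2)) ≤
      ∫⁻ x in Set.Ioo a b, ENNReal.ofReal (1 / 2 * uin' x ^ 2)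
  entropy : ∀ t, 0 < t →
    (∫⁻ s in Set.Ioo 0 t, ∫⁻ x in Set.Ioo a b, ENNReal.ofReal (u s x * uxx s x ^ 2)) +
      ENNReal.ofReal (∫ x in Set.Ioo a b, Beps n ε (uin x)) ≤
      ENNReal.ofReal (∫ x in Set.Ioo a b, toWeakSolution.rho t x)
  rho_equation : ∀ ψ : ℝ × ℝ → ℝ, IsTestFunction (Set.Ioi 0 ×ˢ Set.Ioo a b) ψ →
    - (∫ t in Set.Ioi (0 : ℝ), ∫ x in Set.Ioo a b,
        toWeakSolution.rho t x * deriv (fun τ => ψ (τ, x)) t) =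
      (∫ t in Set.Ioi (0 : ℝ), ∫ x in Set.Ioo a b, toWeakSolution.T t x * ψ (t, x)) -
      ∫ t in Set.Ioi (0 : ℝ), ∫ x in Set.Ioo a b,
        toWeakSolution.R t x * deriv (fun y => ψ (t, y)) x
  T_formula : ∀ᵐ t ∂volume.restrict (Set.Ioi (0 : ℝ)), ∀ φ : ℝ → ℝ, ContDiff ℝ ∞ φ →
    ∫ x in Set.Ioo a b, toWeakSolution.T t x * φ x =
      (∫ x in Set.Ioo a b, u t x * uxx t x ^ 2 * φ x) -
      5 / 6 * (∫ x in Set.Ioo a b, ux t x ^ 3 * deriv φ x) -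
      1 / 2 * ∫ x in Set.Ioo a b, u t x * ux t x ^ 2 * deriv (deriv φ) x

/-- `Σ(t)`: the points `x` of `(a,b)` such that `∫ [1 - ρ(t,y)] dy = 0` over `B_r(x) ∩ (a,b)`
for some `r > 0`. -/
def apparentSupport (a b : ℝ) (ρ : ℝ → ℝ → ℝ) (t : ℝ) : Set ℝ :=
  {x | x ∈ Set.Ioo a b ∧
    ∃ r : ℝ, 0 < r ∧ ∫ y in Metric.ball x r ∩ Set.Ioo a b, (1 - ρ t y) = 0}

end

end ThinFilm

/-! The heart of the matter is that the limit satisfies `∂ₜρ ≥ 0` in the sense of distributions and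
`ρ ≤ 1`. Once both hold, let `I` be an interval on which `1 - ρ(s,·)` has zero integral. For `t > s`
the integral of `1 - ρ(t,·)` over `I` is non-negative because `ρ ≤ 1`, and non-positive because `ρ`
has increased, so it vanishes: the same radius serves at both times.

The bound `ρ ≤ 1` comes from the logarithmic growth of `B` (`B_le`, `Beps_le`): mass and energy
bound `u` by a constant `M`, and `B(M/ε) ≤ B(1) + log M + |ln ε|`.

For monotonicity, test `∂ₜρ^ε = T^ε + ∂ₓR^ε` with products `χ(t) φ(x)` of non-negative functions and
put `κ = |ln ε|^(-1/6)`. The flux is small because `|ln ε| (R^ε)²` is at most a constant times the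
dissipation density (`flux_sq_le`). The source `T^ε = -u uₓ uₓₓₓ` has no pointwise sign, but its
limit is non-negative. Choose a smooth convex `H` vanishing on `[0, κ²]` with `0 ≤ u - H(u) ≤ 2κ²`,
and split `u = H(u) + (u - H(u))`. The part with `H(u)` lives where `u > κ²`, and there the
dissipation controls `uₓₓₓ`. Integrating the other part by parts yields formally `∫ (u-H) uₓₓ² φ +
1/3 ∫ H'' uₓ⁴ φ + 5/3 ∫ (u-H) uₓ uₓₓ φ' + 1/3 ∫ (u-H) uₓ² φ''`. The first two integrals are
non-negative, and the last two are `O(κ)` by the entropy and energy bounds. This is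
`integral_truncated` and `ofReal_neg_integral_le`; space-time integration gives
`ofReal_integral_deriv_mul_rho_le`.

Convergence in `L^p(W^{-1,1})` passes to pairings with a fixed `φ`. A function of time with
non-negative distributional derivative is ordered at its Lebesgue points, off a null set that
depends on `φ` (`exists_null_pairing_mono`). Countably many `φ`, approximating indicators of
rational intervals, suffice to compare integrals over all intervals (`apparentSupport_subset`). -/

namespace ThinFilm

/-! ### Mollified indicators and Lebesgue points -/

section Smoothing

open Set

/-- A sequence of bump functions that concentrates at the origin. -/
noncomputable def shrinkingBump (j : ℕ) : ContDiffBump (0 : ℝ) where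
  rIn := 1 / (j + 1) / 2
  rOut := 1 / (j + 1)
  rIn_pos := by positivity
  rIn_lt_rOut := half_lt_self (by positivity)

lemma tendsto_shrinkingBump_rOut : Tendsto (fun j => (shrinkingBump j).rOut) atTop (𝓝 0) :=
  tendsto_one_div_add_atTop_nhds_zero_nat

/-- The smoothed Heaviside function whose derivative is a normalized bump function. -/
noncomputable def smoothStep (φ : ContDiffBump (0 : ℝ)) (x : ℝ) : ℝ :=
  ∫ y in Iic x, φ.normed volume y

variable (φ : ContDiffBump (0 : ℝ))

lemma hasDerivAt_smoothStep (x : ℝ) : HasDerivAt (smoothStep φ) (φ.normed volume x) x := by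
  have h : smoothStep φ = fun x => smoothStep φ 0 + ∫ y in (0 : ℝ)..x, φ.normed volume y := by
    ext x
    have := intervalIntegral.integral_Iic_sub_Iic
      (φ.integrable_normed (μ := volume)).integrableOn (a := 0)
      (φ.integrable_normed (μ := volume)).integrableOn (b := x)
    simp only [smoothStep]
    linarith
  rw [h]
  exact ((φ.continuous_normed.integral_hasStrictDerivAt 0 x).hasDerivAt).const_add _

lemma contDiff_smoothStep : ContDiff ℝ ∞ (smoothStep φ) := by
  rw [contDiff_infty_iff_deriv]
  refine ⟨fun x => (hasDerivAt_smoothStep φ x).differentiableAt, ?_⟩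
  rw [show deriv (smoothStep φ) = φ.normed volume from
    funext fun x => (hasDerivAt_smoothStep φ x).deriv]
  exact φ.contDiff_normed

lemma smoothStep_mono : Monotone (smoothStep φ) := fun _ _ h =>
  setIntegral_mono_set φ.integrable_normed.integrableOn
    (Eventually.of_forall fun _ => φ.nonneg_normed _) (Iic_subset_Iic.2 h).eventuallyLE

lemma smoothStep_nonneg (x : ℝ) : 0 ≤ smoothStep φ x :=
  integral_nonneg fun _ => φ.nonneg_normed _

lemma smoothStep_le_one (x : ℝ) : smoothStep φ x ≤ 1 := by
  rw [← φ.integral_normed (μ := volume)]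
  exact setIntegral_le_integral φ.integrable_normed (Eventually.of_forall fun _ => φ.nonneg_normed _)

lemma normed_eq_zero {x : ℝ} (h : φ.rOut ≤ |x|) : φ.normed volume x = 0 := by
  rw [← Function.notMem_support, φ.support_normed_eq]
  simpa using h

lemma smoothStep_eq_zero {x : ℝ} (h : x ≤ -φ.rOut) : smoothStep φ x = 0 := by
  refine setIntegral_eq_zero_of_forall_eq_zero fun y hy => normed_eq_zero φ ?_
  rw [abs_of_nonpos] <;> [skip; have := φ.rOut_pos] <;> simp only [mem_Iic] at hy <;> linarith

lemma smoothStep_eq_one {x : ℝ} (h : φ.rOut ≤ x) : smoothStep φ x = 1 := by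
  rw [← φ.integral_normed (μ := volume)]
  refine setIntegral_eq_integral_of_forall_compl_eq_zero fun y hy => normed_eq_zero φ ?_
  simp only [mem_Iic, not_le] at hy
  rw [abs_of_nonneg] <;> [skip; have := φ.rOut_pos] <;> linarith

/-- Between two Lebesgue points `s < t` of an integrable function `f` there are test functions
that converge to the indicator of `(s,t)`, and the pairing of `f` with their derivatives
converges to `f s - f t`. -/
lemma exists_null_forall_testFunction {α β : ℝ} {f : ℝ → ℝ} (hf : IntegrableOn f (Ioo α β)) :
    ∃ N : Set ℝ, volume N = 0 ∧ ∀ s t, s ∉ N → t ∉ N → α < s → s < t → t < β →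
      ∃ χ : ℕ → ℝ → ℝ, (∀ j, IsTestFunction (Ioo α β) (χ j)) ∧ (∀ j x, 0 ≤ χ j x) ∧
        (∀ j x, χ j x ≤ 1) ∧
        (∀ x, x ≠ s → x ≠ t → Tendsto (fun j => χ j x) atTop (𝓝 ((Ioo s t).indicator 1 x))) ∧
        Tendsto (fun j => ∫ x in Ioo α β, f x * deriv (χ j) x) atTop (𝓝 (f s - f t)) := by
  set F := (Ioo α β).indicator f with hF
  have hFi : Integrable F := (integrable_indicator_iff measurableSet_Ioo).2 hf
  -- Differentiation along bumps needs the outer radius bounded by a fixed multiple of the inner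
  -- one; here the ratio is exactly 2. The exceptional set `N` consists of the points where the
  -- mollifications of `F` fail to converge to `F`.
  have key := ContDiffBump.ae_convolution_tendsto_right_of_locallyIntegrable
    (φ := shrinkingBump) (l := atTop) (K := 2) (μ := volume) tendsto_shrinkingBump_rOut
    (Eventually.of_forall fun j => by simp only [shrinkingBump]; linarith)
    hFi.locallyIntegrable
  refine ⟨_, ae_iff.1 key, fun s t hs ht hαs hst htβ => ?_⟩
  simp only [mem_ofPred_eq, not_not] at hs ht
  obtain ⟨J, hJ⟩ := ((tendsto_order.1 tendsto_shrinkingBump_rOut).2 (min (s - α) (β - t) / 2)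
    (by have := sub_pos.2 hαs; have := sub_pos.2 htβ; positivity)).exists_forall_of_atTop
  have hJ' : ∀ j, (shrinkingBump (j + J)).rOut < (s - α) / 2 ∧
      (shrinkingBump (j + J)).rOut < (β - t) / 2 := fun j => by
    have := hJ (j + J) (Nat.le_add_left _ _)
    constructor <;> linarith [min_le_left (s - α) (β - t), min_le_right (s - α) (β - t)]
  -- The test functions are differences of two smoothed steps, at `s` and at `t`. Their derivative
  -- is a bump at `s` minus a bump at `t`, so its pairing with `f` is a difference of two
  -- mollifications. The shift by `J` keeps the supports inside the interval.
  set P : ℕ → ℝ → ℝ := fun j => smoothStep (shrinkingBump (j + J)) with hP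
  have hzero : ∀ j x, x ∉ Icc ((s + α) / 2) ((t + β) / 2) → P j (x - s) - P j (x - t) = 0 := by
    intro j x hx
    obtain ⟨h1, h2⟩ := hJ' j
    rw [mem_Icc, not_and_or, not_le, not_le] at hx
    rcases hx with hx | hx
    · simp only [hP]
      rw [smoothStep_eq_zero, smoothStep_eq_zero, sub_zero] <;> linarith
    · simp only [hP]
      rw [smoothStep_eq_one, smoothStep_eq_one, sub_self] <;> linarith
  have hsm : ∀ j c, ContDiff ℝ ∞ fun x => P j (x - c) := fun j c =>
    (contDiff_smoothStep _).comp (contDiff_id.sub contDiff_const)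
  have hder : ∀ j x, HasDerivAt (fun x => P j (x - s) - P j (x - t))
      ((shrinkingBump (j + J)).normed volume (x - s) -
        (shrinkingBump (j + J)).normed volume (x - t)) x := fun j x => by
    have h1 := (hasDerivAt_smoothStep (shrinkingBump (j + J)) (x - s)).comp_sub_const x s
    have h2 := (hasDerivAt_smoothStep (shrinkingBump (j + J)) (x - t)).comp_sub_const x t
    exact h1.sub h2
  refine ⟨fun j x => P j (x - s) - P j (x - t), fun j => ⟨(hsm j s).sub (hsm j t), ?_, ?_⟩,
    fun j x => sub_nonneg.2 (smoothStep_mono _ (by linarith)), fun j x => ?_, fun x hxs hxt => ?_,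
    ?_⟩
  · exact HasCompactSupport.intro isCompact_Icc (hzero j)
  · refine (closure_minimal (fun x hx => ?_) isClosed_Icc).trans
      (Icc_subset_Ioo (show α < (s + α) / 2 by linarith) (show (t + β) / 2 < β by linarith))
    by_contra hx'
    exact hx (hzero j x hx')
  · have := smoothStep_le_one (shrinkingBump (j + J)) (x - s)
    have := smoothStep_nonneg (shrinkingBump (j + J)) (x - t)
    simp only [hP]
    linarith
  · have hlim : Tendsto (fun j => (shrinkingBump (j + J)).rOut) atTop (𝓝 0) :=
      tendsto_shrinkingBump_rOut.comp (tendsto_add_atTop_nat J)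
    have hstep : ∀ c, x ≠ c → Tendsto (fun j => P j (x - c)) atTop
        (𝓝 ((Ioi c).indicator 1 x)) := by
      intro c hc
      rcases lt_or_gt_of_ne hc with h | h
      · refine tendsto_const_nhds.congr' ?_
        filter_upwards [(tendsto_order.1 hlim).2 (c - x) (by linarith)] with j hj
        rw [indicator_of_notMem (by simpa using h.le)]
        exact (smoothStep_eq_zero _ (by linarith)).symm
      · refine tendsto_const_nhds.congr' ?_
        filter_upwards [(tendsto_order.1 hlim).2 (x - c) (by linarith)] with j hj
        rw [indicator_of_mem (by simpa using h)]
        exact (smoothStep_eq_one _ (by linarith)).symm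
    convert (hstep s hxs).sub (hstep t hxt) using 2
    by_cases h1 : s < x
    · rcases lt_or_gt_of_ne hxt with h2 | h2
      · simp [indicator, h1, h2, not_lt.2 h2.le]
      · simp [indicator, h1, h2, not_lt.2 h2.le]
    · simp [indicator, h1, not_lt.2 ((not_lt.1 h1).trans hst.le)]
  · have h1 := (hs.comp (tendsto_add_atTop_nat J)).sub (ht.comp (tendsto_add_atTop_nat J))
    rw [hF, indicator_of_mem (show s ∈ Ioo α β from ⟨hαs, hst.trans htβ⟩),
      indicator_of_mem (show t ∈ Ioo α β from ⟨hαs.trans hst, htβ⟩), ← hF] at h1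
    refine h1.congr fun j => ?_
    have hconv : ∀ c, convolution ((shrinkingBump (j + J)).normed volume) F
        (ContinuousLinearMap.lsmul ℝ ℝ) volume c = ∫ x in Ioo α β, f x * (shrinkingBump (j + J)).normed volume (x - c) := by
      intro c
      rw [convolution_lsmul_swap, ← integral_indicator measurableSet_Ioo]
      refine integral_congr_ae (Eventually.of_forall fun x => ?_)
      by_cases hx : x ∈ Ioo α β
      · simp only [hF, indicator_of_mem hx, smul_eq_mul]
        rw [← ContDiffBump.normed_neg, neg_sub, mul_comm]
      · simp [hF, indicator_of_notMem hx]
    have hint : ∀ c, IntegrableOn (fun x => f x * (shrinkingBump (j + J)).normed volume (x - c))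
        (Ioo α β) := fun c => by
      have hc : Continuous fun x : ℝ => (shrinkingBump (j + J)).normed volume (x - c) :=
        (shrinkingBump (j + J)).continuous_normed.comp (continuous_id.sub continuous_const)
      obtain ⟨C, hC⟩ := ((shrinkingBump (j + J)).hasCompactSupport_normed
        (μ := volume)).exists_bound_of_continuous (shrinkingBump (j + J)).continuous_normed
      exact hf.mul_bdd hc.aestronglyMeasurable (Eventually.of_forall fun x => hC _)
    simp only [Function.comp_apply]
    rw [hconv, hconv, ← integral_sub (hint s) (hint t)]
    refine integral_congr_ae (Eventually.of_forall fun x => ?_)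
    simp only [(hder j x).deriv]
    ring

end Smoothing

/-! ### Weak derivatives on open subsets of the line -/

section WeakDerivative

open Set

lemma setIntegral_eq_of_support_subset {U V : Set ℝ} (hU : MeasurableSet U)
    (hVU : V ⊆ U) {F : ℝ → ℝ} (h : ∀ x, x ∉ V → F x = 0) :
    ∫ x in V, F x = ∫ x in U, F x :=
  (setIntegral_eq_of_subset_of_forall_sdiff_eq_zero hU hVU fun x hx => h x hx.2).symm

lemma setIntegral_mul_indicator_one {U V : Set ℝ} (hU : MeasurableSet U) (hV : MeasurableSet V)
    (hVU : V ⊆ U) (w : ℝ → ℝ) : ∫ x in U, w x * V.indicator 1 x = ∫ x in V, w x := by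
  rw [← integral_indicator hU, ← integral_indicator hV]
  refine integral_congr_ae (Eventually.of_forall fun x => ?_)
  by_cases hx : x ∈ V
  · simp only [indicator_of_mem hx, indicator_of_mem (hVU hx), Pi.one_apply, mul_one]
  · simp only [indicator_of_notMem hx, indicator_apply_eq_zero, mul_zero, implies_true]

lemma IsTestFunction.continuous {φ : ℝ → ℝ} {U : Set ℝ} (h : IsTestFunction U φ) :
    Continuous φ := h.1.continuous

lemma IsTestFunction.eq_zero {φ : ℝ → ℝ} {U : Set ℝ} (h : IsTestFunction U φ) {x : ℝ}
    (hx : x ∉ U) : φ x = 0 :=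
  image_eq_zero_of_notMem_tsupport fun h' => hx (h.2.2 h')

lemma IsTestFunction.deriv {φ : ℝ → ℝ} {U : Set ℝ} (h : IsTestFunction U φ) :
    IsTestFunction U (deriv φ) :=
  ⟨(contDiff_infty_iff_deriv.1 h.1).2, h.2.1.deriv, (tsupport_deriv_subset (f := φ)).trans h.2.2⟩

lemma IsTestFunction.mono {E : Type*} [NormedAddCommGroup E] [NormedSpace ℝ E] {φ : E → ℝ}
    {U V : Set E} (h : IsTestFunction U φ) (hUV : U ⊆ V) :
    IsTestFunction V φ := ⟨h.1, h.2.1, h.2.2.trans hUV⟩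

lemma IsTestFunction.exists_bound {φ : ℝ → ℝ} {U : Set ℝ} (h : IsTestFunction U φ) :
    ∃ C, 0 ≤ C ∧ ∀ x, |φ x| ≤ C := by
  obtain ⟨C, hC⟩ := h.2.1.exists_bound_of_continuous h.continuous
  exact ⟨C, (norm_nonneg _).trans (hC 0), hC⟩

variable {U : Set ℝ} {f g : ℝ → ℝ}

/-- Testing with approximations of the indicator of `(s,t)` gives `f t - f s = ∫ g` between Lebesgue
points; fixing one such point `s₀` determines the constant. -/
lemma HasWeakDerivOn.exists_ae_eq (h : HasWeakDerivOn U f g) (hU : IsOpen U) {c d : ℝ}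
    (hcd : c < d) (hsub : Icc c d ⊆ U) :
    ∃ C, ∀ᵐ x ∂volume.restrict (Ioo c d), f x = C + ∫ y in c..x, g y := by
  have hfi : IntegrableOn f (Icc c d) := h.1.integrableOn_compact_subset hsub isCompact_Icc
  have hgi : IntegrableOn g (Icc c d) := h.2.1.integrableOn_compact_subset hsub isCompact_Icc
  have hgI : ∀ x ∈ Icc c d, ∀ y ∈ Icc c d, IntervalIntegrable g volume x y := fun x hx y hy => by
    rw [intervalIntegrable_iff]
    exact hgi.mono_set (uIoc_subset_uIcc.trans (uIcc_subset_Icc hx hy))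
  obtain ⟨N, hN, H⟩ := exists_null_forall_testFunction (hfi.mono_set Ioo_subset_Icc_self)
  have hpair : ∀ s t, s ∉ N → t ∉ N → c < s → s < t → t < d → f t - f s = ∫ y in s..t, g y := by
    intro s t hs ht hcs hst htd
    obtain ⟨χ, hχ, hχ0, hχ1, hχlim, hχf⟩ := H s t hs ht hcs hst htd
    have hIU : Ioo c d ⊆ U := Ioo_subset_Icc_self.trans hsub
    have h1 : ∀ j, ∫ x in Ioo c d, f x * deriv (χ j) x = - ∫ x in Ioo c d, g x * χ j x := fun j => by
      rw [setIntegral_eq_of_support_subset hU.measurableSet hIU fun x hx => by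
          rw [(hχ j).deriv.eq_zero hx, mul_zero],
        setIntegral_eq_of_support_subset hU.measurableSet hIU fun x hx => by
          rw [(hχ j).eq_zero hx, mul_zero]]
      exact h.2.2 _ ((hχ j).mono hIU)
    have h2 : Tendsto (fun j => ∫ x in Ioo c d, g x * χ j x) atTop
        (𝓝 (∫ x in Ioo c d, g x * (Ioo s t).indicator 1 x)) := by
      refine tendsto_integral_of_dominated_convergence (fun x => |g x|) (fun j => ?_)
        (hgi.mono_set Ioo_subset_Icc_self).abs (fun j => Eventually.of_forall fun x => ?_) ?_
      · exact (hgi.mono_set Ioo_subset_Icc_self).aestronglyMeasurable.mul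
          (hχ j).continuous.aestronglyMeasurable
      · rw [norm_mul, Real.norm_eq_abs, Real.norm_eq_abs, abs_of_nonneg (hχ0 j x)]
        exact mul_le_of_le_one_right (abs_nonneg _) (hχ1 j x)
      · have hne : ∀ e : ℝ, ∀ᵐ x ∂volume.restrict (Ioo c d), x ≠ e := fun e =>
          ae_restrict_of_ae (Measure.ae_ne volume e)
        filter_upwards [hne s, hne t] with x hxs hxt
        exact (hχlim x hxs hxt).const_mul _
    have h3 : ∫ x in Ioo c d, g x * (Ioo s t).indicator 1 x = ∫ y in s..t, g y := by
      rw [intervalIntegral.integral_of_le hst.le, integral_Ioc_eq_integral_Ioo]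
      exact setIntegral_mul_indicator_one measurableSet_Ioo measurableSet_Ioo
        (Ioo_subset_Ioo hcs.le htd.le) g
    have h4 := tendsto_nhds_unique hχf (by simpa only [h1] using h2.neg)
    rw [h3] at h4
    linarith
  have hNae : ∀ᵐ x, x ∉ N := measure_eq_zero_iff_ae_notMem.1 hN
  obtain ⟨s₀, hs₀, hs₀N⟩ : ∃ s ∈ Ioo c d, s ∉ N := by
    by_contra! hcon
    have : volume (Ioo c d) = 0 := measure_mono_null hcon hN
    simp [hcd.not_ge] at this
  have hmem := Ioo_subset_Icc_self hs₀
  have hc : c ∈ Icc c d := left_mem_Icc.2 hcd.le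
  refine ⟨f s₀ - ∫ y in c..s₀, g y, ?_⟩
  filter_upwards [ae_restrict_mem measurableSet_Ioo, ae_restrict_of_ae hNae] with x hx hxN
  have hx' := Ioo_subset_Icc_self hx
  have hadd := intervalIntegral.integral_add_adjacent_intervals (hgI c hc _ hmem) (hgI _ hmem x hx')
  rcases lt_trichotomy s₀ x with hlt | heq | hgt
  · have := hpair s₀ x hs₀N hxN hs₀.1 hlt hx.2
    linarith
  · subst heq; ring
  · have := hpair x s₀ hxN hs₀N hx.1 hgt hs₀.2
    rw [intervalIntegral.integral_symm] at this
    linarith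

lemma exists_Icc_subset (hU : IsOpen U) {x : ℝ} (hx : x ∈ U) :
    ∃ c d, x ∈ Ioo c d ∧ Icc c d ⊆ U := by
  obtain ⟨r, hr, hrU⟩ := Metric.isOpen_iff.1 hU x hx
  refine ⟨x - r / 2, x + r / 2, ⟨by linarith, by linarith⟩, fun y hy => hrU ?_⟩
  rw [Metric.mem_ball, Real.dist_eq, abs_lt]
  constructor <;> linarith [hy.1, hy.2]

/-- Continuity of `f` upgrades the almost everywhere primitive formula to every point, and the
fundamental theorem of calculus applies to the continuous representative `k` of `g`. -/
lemma HasWeakDerivOn.hasDerivAt (h : HasWeakDerivOn U f g) (hU : IsOpen U)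
    (hf : ContinuousOn f U) {c d : ℝ} (hsub : Icc c d ⊆ U) {k : ℝ → ℝ}
    (hk : ContinuousOn k (Ioo c d)) (hgk : ∀ᵐ x ∂volume.restrict (Ioo c d), g x = k x)
    {x : ℝ} (hx : x ∈ Ioo c d) : HasDerivAt f (k x) x := by
  obtain ⟨C, hC⟩ := h.exists_ae_eq hU (hx.1.trans hx.2) hsub
  have hcd : c ≤ d := (hx.1.trans hx.2).le
  have hgi : IntegrableOn g (Icc c d) := h.2.1.integrableOn_compact_subset hsub isCompact_Icc
  have hgint : ∀ y ∈ Icc c d, IntervalIntegrable g volume c y := fun y hy => by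
    rw [intervalIntegrable_iff, uIoc_of_le hy.1]
    exact hgi.mono_set fun z hz => ⟨hz.1.le, hz.2.trans hy.2⟩
  have hprim : ContinuousOn (fun x => C + ∫ y in c..x, g y) (Ioo c d) := by
    refine continuousOn_const.add
      ((intervalIntegral.continuousOn_primitive_interval (b := d) ?_).mono ?_)
    · rwa [uIcc_of_le hcd]
    · rw [uIcc_of_le hcd]; exact Ioo_subset_Icc_self
  have heq : EqOn f (fun x => C + ∫ y in c..x, g y) (Ioo c d) :=
    Measure.eqOn_open_of_ae_eq hC isOpen_Ioo (hf.mono (Ioo_subset_Icc_self.trans hsub)) hprim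
  have hgk' : ∀ᵐ y ∂volume, y ∈ Ioo c d → g y = k y := (ae_restrict_iff' measurableSet_Ioo).1 hgk
  have heq2 : ∀ y ∈ Ioo c d, f y = f x + ∫ z in x..y, k z := fun y hy => by
    rw [heq hy, heq hx]
    have h1 := intervalIntegral.integral_interval_sub_left (hgint y (Ioo_subset_Icc_self hy))
      (hgint x (Ioo_subset_Icc_self hx))
    have h2 : ∫ z in x..y, g z = ∫ z in x..y, k z := by
      refine intervalIntegral.integral_congr_ae ?_
      filter_upwards [hgk'] with z hz hzm
      refine hz ?_
      have := uIoc_subset_uIcc hzm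
      exact (ordConnected_Ioo.uIcc_subset hx hy) this
    simp only
    linarith
  have hnhds : Ioo c d ∈ 𝓝 x := isOpen_Ioo.mem_nhds hx
  have hd : HasDerivAt (fun y => f x + ∫ z in x..y, k z) (k x) x := by
    refine HasDerivAt.const_add _ (intervalIntegral.integral_hasDerivAt_right
      IntervalIntegrable.refl ?_ (hk.continuousAt hnhds))
    exact hk.stronglyMeasurableAtFilter isOpen_Ioo x hx
  exact hd.congr_of_eventuallyEq (by filter_upwards [hnhds] with y hy using heq2 y hy)

lemma HasWeakDerivOn.hasDerivAt_of_continuousOn (h : HasWeakDerivOn U f g) (hU : IsOpen U)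
    (hf : ContinuousOn f U) (hg : ContinuousOn g U) {x : ℝ} (hx : x ∈ U) :
    HasDerivAt f (g x) x := by
  obtain ⟨c, d, hxI, hsub⟩ := exists_Icc_subset hU hx
  exact h.hasDerivAt hU hf hsub (hg.mono (Ioo_subset_Icc_self.trans hsub))
    (Eventually.of_forall fun _ => rfl) hxI

/-- A continuous function with two weak derivatives is continuously differentiable. -/
lemma HasWeakDerivOn.contDiffOn_of_second {k : ℝ → ℝ} (h : HasWeakDerivOn U f g)
    (h' : HasWeakDerivOn U g k) (hU : IsOpen U) (hf : ContinuousOn f U) :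
    ContDiffOn ℝ 1 f U ∧ ∀ᵐ x ∂volume.restrict U, g x = deriv f x := by
  -- Near each point `g` agrees almost everywhere with a primitive of `k`; this continuous
  -- representative is the classical derivative of `f`.
  have key : ∀ x ∈ U, ∃ V, IsOpen V ∧ x ∈ V ∧ V ⊆ U ∧ ∃ G : ℝ → ℝ, ContinuousOn G V ∧
      (∀ᵐ y ∂volume.restrict V, g y = G y) ∧ ∀ y ∈ V, HasDerivAt f (G y) y := by
    intro x hx
    obtain ⟨c, d, hxI, hsub⟩ := exists_Icc_subset hU hx
    have hcd := hxI.1.trans hxI.2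
    obtain ⟨C, hC⟩ := h'.exists_ae_eq hU hcd hsub
    have hprim : ContinuousOn (fun x => C + ∫ y in c..x, k y) (Ioo c d) := by
      refine continuousOn_const.add
        ((intervalIntegral.continuousOn_primitive_interval (b := d) ?_).mono ?_)
      · rw [uIcc_of_le hcd.le]
        exact h'.2.1.integrableOn_compact_subset hsub isCompact_Icc
      · rw [uIcc_of_le hcd.le]; exact Ioo_subset_Icc_self
    exact ⟨Ioo c d, isOpen_Ioo, hxI, Ioo_subset_Icc_self.trans hsub, _, hprim, hC,
      fun y hy => h.hasDerivAt hU hf hsub hprim hC hy⟩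
  constructor
  · rw [show (1 : WithTop ℕ∞) = 0 + 1 from rfl, contDiffOn_succ_iff_deriv_of_isOpen hU]
    refine ⟨fun x hx => ?_, by simp, ?_⟩
    · obtain ⟨V, hV, hxV, -, G, -, -, hd⟩ := key x hx
      exact (hd x hxV).differentiableAt.differentiableWithinAt
    · rw [contDiffOn_zero]
      intro x hx
      obtain ⟨V, hV, hxV, -, G, hG, -, hd⟩ := key x hx
      refine ((hG.continuousAt (hV.mem_nhds hxV)).congr ?_).continuousWithinAt
      filter_upwards [hV.mem_nhds hxV] with y hy using (hd y hy).deriv.symm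
  · rw [ae_restrict_iff' hU.measurableSet, ae_iff]
    refine measure_null_of_locally_null _ fun x hx => ?_
    simp only [mem_ofPred_eq, Classical.not_imp] at hx
    obtain ⟨V, hV, hxV, -, G, -, hgG, hd⟩ := key x hx.1
    refine ⟨V ∩ {x | ¬(x ∈ U → g x = deriv f x)},
      inter_mem (mem_nhdsWithin_of_mem_nhds (hV.mem_nhds hxV)) self_mem_nhdsWithin, ?_⟩
    rw [ae_restrict_iff' hV.measurableSet, ae_iff] at hgG
    refine measure_mono_null (fun y hy => ?_) hgG
    simp only [mem_inter_iff, mem_ofPred_eq, Classical.not_imp] at hy ⊢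
    exact ⟨hy.1, by rw [← (hd y hy.1).deriv]; exact hy.2.2⟩

lemma integral_deriv_eq_zero_of_hasCompactSupport {F : ℝ → ℝ} (hF : ContDiff ℝ 1 F)
    (hc : HasCompactSupport F) : ∫ x, deriv F x = 0 :=
  integral_eq_zero_of_hasDerivAt_of_integrable
    (fun x => ((hF.differentiable one_ne_zero) x).hasDerivAt)
    ((hF.continuous_deriv le_rfl).integrable_of_hasCompactSupport hc.deriv)
    (hF.continuous.integrable_of_hasCompactSupport hc)

/-- Weak derivatives can be tested with compactly supported functions of class `C¹`. -/
lemma HasWeakDerivOn.integral_mul_deriv (h : HasWeakDerivOn U f g) (hU : IsOpen U) {F : ℝ → ℝ}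
    (hF : ContDiff ℝ 1 F) (hc : HasCompactSupport F) (hFU : tsupport F ⊆ U) :
    ∫ x in U, f x * deriv F x = - ∫ x in U, g x * F x := by
  -- Mollify `F`. Once the kernel radius is below `r`, all supports lie in one compact `K ⊆ U`,
  -- where `f` and `g` are integrable; this supplies the dominating function.
  obtain ⟨r, hr, hrU⟩ : ∃ r > 0, Metric.cthickening r (tsupport F) ⊆ U :=
    hc.exists_cthickening_subset_open hU hFU
  set K := Metric.cthickening r (tsupport F) with hK
  have hKc : IsCompact K := IsCompact.cthickening hc
  set Φ : ℕ → ℝ → ℝ := fun j => convolution ((shrinkingBump j).normed volume) F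
    (ContinuousLinearMap.lsmul ℝ ℝ) volume with hΦ
  set Φ' : ℕ → ℝ → ℝ := fun j => convolution ((shrinkingBump j).normed volume) (deriv F)
    (ContinuousLinearMap.lsmul ℝ ℝ) volume with hΦ'
  have hder : ∀ j x, HasDerivAt (Φ j) (Φ' j x) x := fun j x =>
    hc.hasDerivAt_convolution_right (ContinuousLinearMap.lsmul ℝ ℝ)
      ((shrinkingBump j).continuous_normed.locallyIntegrable) hF x
  have hsmooth : ∀ j, ContDiff ℝ ∞ (Φ j) := fun j =>
    (shrinkingBump j).hasCompactSupport_normed.contDiff_convolution_left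
      (ContinuousLinearMap.lsmul ℝ ℝ) (shrinkingBump j).contDiff_normed
      hF.continuous.locallyIntegrable
  obtain ⟨J, hJ⟩ := ((tendsto_order.1 tendsto_shrinkingBump_rOut).2 r hr).exists_forall_of_atTop
  have hsupp : ∀ j, J ≤ j → ∀ x, x ∉ K → Φ j x = 0 := by
    intro j hj x hx
    by_contra hne
    have h1 := support_convolution_subset (ContinuousLinearMap.lsmul ℝ ℝ)
      (μ := volume) (Function.mem_support.2 hne)
    rw [(shrinkingBump j).support_normed_eq] at h1
    obtain ⟨y, hy, z, hz, rfl⟩ := h1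
    refine hx (Metric.mem_cthickening_of_dist_le _ z _ _ (subset_tsupport _ hz) ?_)
    rw [Real.dist_eq, add_sub_cancel_right, ← Real.norm_eq_abs]
    exact ((mem_ball_zero_iff.1 hy).trans (hJ j hj)).le
  have htest : ∀ j, J ≤ j → IsTestFunction U (Φ j) := fun j hj =>
    ⟨hsmooth j, HasCompactSupport.intro hKc (hsupp j hj),
      (closure_minimal (fun x hx => by_contra fun hx' => (Function.mem_support.1 hx) (hsupp j hj x hx'))
        hKc.isClosed).trans hrU⟩
  have hbound : ∀ {k : ℝ → ℝ} {C : ℝ}, Continuous k → (∀ x, ‖k x‖ ≤ C) → ∀ j x,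
      ‖convolution ((shrinkingBump j).normed volume) k
        (ContinuousLinearMap.lsmul ℝ ℝ) volume x‖ ≤ C := by
    intro k C hk hkC j x
    rw [convolution_lsmul]
    have hC : ∫ t, (shrinkingBump j).normed volume t * C = C := by
      rw [integral_mul_const, (shrinkingBump j).integral_normed, one_mul]
    rw [← hC]
    refine norm_integral_le_of_norm_le
      ((shrinkingBump j).integrable_normed.mul_const C) (Eventually.of_forall fun t => ?_)
    rw [smul_eq_mul, norm_mul, Real.norm_of_nonneg ((shrinkingBump j).nonneg_normed t)]
    exact mul_le_mul_of_nonneg_left (hkC _) ((shrinkingBump j).nonneg_normed t)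
  have hlim : ∀ {k l : ℝ → ℝ} {Ψ : ℕ → ℝ → ℝ}, LocallyIntegrableOn k U → Continuous l →
      HasCompactSupport l → (∀ j, Ψ j = convolution ((shrinkingBump j).normed volume) l
        (ContinuousLinearMap.lsmul ℝ ℝ) volume) → (∀ j, Continuous (Ψ j)) →
      (∀ j, J ≤ j → ∀ x, x ∉ K → Ψ j x = 0) →
      Tendsto (fun j => ∫ x in U, k x * Ψ j x) atTop (𝓝 (∫ x in U, k x * l x)) := by
    intro k l Ψ hk hl hlc hΨ hΨc hΨ0
    obtain ⟨C, hC⟩ := hlc.exists_bound_of_continuous hl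
    have hkK : IntegrableOn k K := hk.integrableOn_compact_subset hrU hKc
    have hkm : AEStronglyMeasurable k (volume.restrict U) := hk.aestronglyMeasurable
    refine tendsto_integral_filter_of_dominated_convergence
      (fun x => K.indicator (fun x => |k x| * C) x) ?_ ?_ ?_ ?_
    · exact Eventually.of_forall fun j => hkm.mul (hΨc j).aestronglyMeasurable
    · filter_upwards [eventually_ge_atTop J] with j hj
      refine Eventually.of_forall fun x => ?_
      by_cases hx : x ∈ K
      · rw [indicator_of_mem hx, norm_mul, hΨ]
        exact mul_le_mul_of_nonneg_left (hbound hl hC j x) (norm_nonneg _)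
      · rw [indicator_of_notMem hx, hΨ0 j hj x hx, mul_zero, norm_zero]
    · exact ((integrable_indicator_iff hKc.measurableSet).2 (hkK.abs.mul_const C)).restrict
    · refine Eventually.of_forall fun x => ?_
      simp only [hΨ]
      exact (ContDiffBump.convolution_tendsto_right_of_continuous
        tendsto_shrinkingBump_rOut hl x).const_mul _
  have hd' : ∀ j, deriv (Φ j) = Φ' j := fun j => funext fun x => (hder j x).deriv
  have hl1 : Tendsto (fun j => ∫ x in U, f x * deriv (Φ j) x) atTop
      (𝓝 (∫ x in U, f x * deriv F x)) := by
    refine hlim h.1 (hF.continuous_deriv le_rfl) hc.deriv hd' (fun j => ?_) fun j hj x hx => ?_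
    · exact (hsmooth j).continuous_deriv (by simp)
    · have hopen : Kᶜ ∈ 𝓝 x := hKc.isClosed.isOpen_compl.mem_nhds hx
      have : Φ j =ᶠ[𝓝 x] fun _ => 0 := by
        filter_upwards [hopen] with y hy using hsupp j hj y hy
      rw [this.deriv_eq, deriv_const]
  have hl2 : Tendsto (fun j => ∫ x in U, g x * Φ j x) atTop (𝓝 (∫ x in U, g x * F x)) :=
    hlim h.2.1 hF.continuous hc (fun _ => rfl) (fun j => (hsmooth j).continuous) hsupp
  refine tendsto_nhds_unique hl1 (hl2.neg.congr' ?_)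
  filter_upwards [eventually_ge_atTop J] with j hj using (h.2.2 _ (htest j hj)).symm

end WeakDerivative

/-! ### The convex truncation `H` -/

section Truncation

/-- The derivative of the smooth truncation `smoothPart δ`. -/
noncomputable def smoothSlope (δ s : ℝ) : ℝ := Real.smoothTransition ((s - δ) / δ)

/-- A smooth convex approximation of `s ↦ (s - δ)₊` which vanishes for `s ≤ δ`. -/
noncomputable def smoothPart (δ s : ℝ) : ℝ := ∫ r in (0 : ℝ)..s, smoothSlope δ r

lemma contDiff_smoothSlope (δ : ℝ) : ContDiff ℝ ∞ (smoothSlope δ) :=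
  Real.smoothTransition.contDiff.comp ((contDiff_id.sub contDiff_const).div_const δ)

lemma hasDerivAt_smoothPart (δ s : ℝ) : HasDerivAt (smoothPart δ) (smoothSlope δ s) s :=
  ((contDiff_smoothSlope δ).continuous.integral_hasStrictDerivAt 0 s).hasDerivAt

lemma continuous_smoothPart (δ : ℝ) : Continuous (smoothPart δ) :=
  continuous_iff_continuousAt.2 fun s => (hasDerivAt_smoothPart δ s).continuousAt

lemma hasDerivAt_smoothSlope (δ s : ℝ) :
    HasDerivAt (smoothSlope δ) (deriv (smoothSlope δ) s) s :=
  ((contDiff_smoothSlope δ).differentiable (by simp) s).hasDerivAt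

lemma continuous_deriv_smoothSlope (δ : ℝ) : Continuous (deriv (smoothSlope δ)) :=
  (contDiff_smoothSlope δ).continuous_deriv (by simp)

lemma smoothSlope_nonneg (δ s : ℝ) : 0 ≤ smoothSlope δ s := Real.smoothTransition.nonneg _

lemma smoothSlope_le_one (δ s : ℝ) : smoothSlope δ s ≤ 1 := Real.smoothTransition.le_one _

variable {δ s : ℝ}

lemma deriv_smoothSlope_nonneg (hδ : 0 < δ) : 0 ≤ deriv (smoothSlope δ) s := by
  refine Monotone.deriv_nonneg fun x y hxy => Real.smoothTransition.monotone ?_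
  gcongr

lemma smoothSlope_eq_zero (hδ : 0 < δ) (hs : s ≤ δ) : smoothSlope δ s = 0 :=
  Real.smoothTransition.zero_of_nonpos (div_nonpos_of_nonpos_of_nonneg (by linarith) hδ.le)

lemma smoothSlope_eq_one (hδ : 0 < δ) (hs : 2 * δ ≤ s) : smoothSlope δ s = 1 :=
  Real.smoothTransition.one_of_one_le (by rw [le_div_iff₀ hδ]; linarith)

lemma smoothPart_eq_zero (hδ : 0 < δ) (hs : s ≤ δ) : smoothPart δ s = 0 := by
  rw [smoothPart, intervalIntegral.integral_zero_ae]
  refine Eventually.of_forall fun r hr => smoothSlope_eq_zero hδ ?_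
  exact (Set.mem_uIoc.1 hr).elim (fun h => h.2.trans hs) fun h => h.2.trans hδ.le

lemma smoothPart_nonneg (hs : 0 ≤ s) : 0 ≤ smoothPart δ s :=
  intervalIntegral.integral_nonneg hs fun _ _ => smoothSlope_nonneg _ _

lemma sub_smoothPart_eq (δ s : ℝ) :
    s - smoothPart δ s = ∫ r in (0 : ℝ)..s, (1 - smoothSlope δ r) := by
  rw [intervalIntegral.integral_sub intervalIntegrable_const
    ((contDiff_smoothSlope δ).continuous.intervalIntegrable _ _)]
  simp [smoothPart]

lemma smoothPart_le (hs : 0 ≤ s) : smoothPart δ s ≤ s := by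
  rw [← sub_nonneg, sub_smoothPart_eq]
  exact intervalIntegral.integral_nonneg hs fun _ _ => sub_nonneg.2 (smoothSlope_le_one _ _)

/-- The slope of `H` equals 1 beyond `2δ`, so the deficit `s - H(s)` stops growing there. -/
lemma sub_smoothPart_le (hδ : 0 < δ) (hs : 0 ≤ s) : s - smoothPart δ s ≤ 2 * δ := by
  rcases le_total s (2 * δ) with h | h
  · linarith [smoothPart_nonneg (δ := δ) hs]
  · have hc : Continuous fun r => 1 - smoothSlope δ r :=
      continuous_const.sub (contDiff_smoothSlope δ).continuous
    rw [sub_smoothPart_eq, ← intervalIntegral.integral_add_adjacent_intervals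
      (hc.intervalIntegrable 0 (2 * δ)) (hc.intervalIntegrable (2 * δ) s)]
    have h2 : ∫ r in (2 * δ)..s, (1 - smoothSlope δ r) = 0 := by
      refine intervalIntegral.integral_zero_ae (Eventually.of_forall fun r hr => ?_)
      rw [Set.uIoc_of_le h] at hr
      rw [smoothSlope_eq_one hδ hr.1.le, sub_self]
    rw [h2, add_zero, ← sub_smoothPart_eq]
    linarith [smoothPart_nonneg (δ := δ) (by linarith : 0 ≤ 2 * δ)]

end Truncation

/-! ### Time slices and the truncated integration by parts -/

section Profile

open Set

/-- A function on `(a,b)` with the regularity of a solution at almost every time. -/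
structure IsProfile (a b : ℝ) (u ux uxx uxxx : ℝ → ℝ) : Prop where
  continuousOn_u : ContinuousOn u (Icc a b)
  nonneg : ∀ x ∈ Icc a b, 0 ≤ u x
  weakDeriv_u : HasWeakDerivOn (Ioo a b) u ux
  continuousOn_ux : ContinuousOn ux (Icc a b)
  weakDeriv_ux : HasWeakDerivOn {x | x ∈ Ioo a b ∧ 0 < u x} ux uxx
  weakDeriv_uxx : HasWeakDerivOn {x | x ∈ Ioo a b ∧ 0 < u x} uxx uxxx
  measurable_uxx : Measurable uxx
  measurable_uxxx : Measurable uxxx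
  integrable_entropy : IntegrableOn (fun x => u x * uxx x ^ 2) (Ioo a b)
  integrable_uxxx : IntegrableOn (fun x => u x * uxxx x) (Ioo a b)

/-- The positivity set of a function on `(a,b)`. -/
def posSet (a b : ℝ) (u : ℝ → ℝ) : Set ℝ := {x | x ∈ Ioo a b ∧ 0 < u x}

/-- Products such as `uₓ H(u) φ` are `C¹` only in the positivity set, but vanish off a compact part
of it; extended by zero they are admissible test functions on the whole line. -/
lemma contDiff_of_hasDerivAt_of_eq_zero {U K : Set ℝ} (hU : IsOpen U) (hK : IsCompact K)
    (hKU : K ⊆ U) {P P' : ℝ → ℝ} (hP : ∀ x ∈ U, HasDerivAt P (P' x) x) (hP' : ContinuousOn P' U)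
    (h0 : ∀ x, x ∉ K → P x = 0) :
    ContDiff ℝ 1 P ∧ HasCompactSupport P ∧ tsupport P ⊆ U ∧
      (∀ x ∈ U, deriv P x = P' x) ∧ ∀ x, x ∉ K → deriv P x = 0 := by
  have hout : ∀ x, x ∉ K → P =ᶠ[𝓝 x] fun _ => 0 := fun x hx => by
    filter_upwards [hK.isClosed.isOpen_compl.mem_nhds hx] with y hy using h0 y hy
  have hd : ∀ x ∈ U, deriv P x = P' x := fun x hx => (hP x hx).deriv
  refine ⟨contDiff_iff_contDiffAt.2 fun x => ?_, HasCompactSupport.intro hK h0, ?_, hd,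
    fun x hx => by rw [(hout x hx).deriv_eq, deriv_const]⟩
  · by_cases hx : x ∈ K
    · have hon : ContDiffOn ℝ 1 P U := by
        rw [show (1 : WithTop ℕ∞) = 0 + 1 from rfl, contDiffOn_succ_iff_deriv_of_isOpen hU]
        refine ⟨fun y hy => (hP y hy).differentiableAt.differentiableWithinAt, by simp, ?_⟩
        exact contDiffOn_zero.2 (hP'.congr hd)
      exact hon.contDiffAt (hU.mem_nhds (hKU hx))
    · exact contDiffAt_const.congr_of_eventuallyEq (hout x hx)
  · exact (closure_minimal (fun x hx => by_contra fun h => (Function.mem_support.1 hx) (h0 x h))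
      hK.isClosed).trans hKU

lemma integral_eq_zero_of_hasDerivAt_of_eq_zero {U K : Set ℝ} (hU : IsOpen U) (hK : IsCompact K)
    (hKU : K ⊆ U) {P P' : ℝ → ℝ} (hP : ∀ x ∈ U, HasDerivAt P (P' x) x) (hP' : ContinuousOn P' U)
    (h0 : ∀ x, x ∉ K → P x = 0) : IntegrableOn P' U ∧ ∫ x in U, P' x = 0 := by
  obtain ⟨h1, h2, -, h4, h5⟩ := contDiff_of_hasDerivAt_of_eq_zero hU hK hKU hP hP' h0
  constructor
  · refine IntegrableOn.congr_fun (f := deriv P) ?_ h4 hU.measurableSet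
    exact ((h1.continuous_deriv le_rfl).integrable_of_hasCompactSupport h2.deriv).integrableOn
  · rw [← setIntegral_congr_fun hU.measurableSet h4,
      setIntegral_eq_integral_of_forall_compl_eq_zero fun x hx => h5 x fun h => hx (hKU h)]
    exact integral_deriv_eq_zero_of_hasCompactSupport h1 h2

lemma integral_linear_combination_nine {μ : Measure ℝ} {f₁ f₂ f₃ f₄ f₅ f₆ f₇ f₈ f₉ : ℝ → ℝ}
    (h₁ : Integrable f₁ μ) (h₂ : Integrable f₂ μ) (h₃ : Integrable f₃ μ) (h₄ : Integrable f₄ μ)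
    (h₅ : Integrable f₅ μ) (h₆ : Integrable f₆ μ) (h₇ : Integrable f₇ μ) (h₈ : Integrable f₈ μ)
    (h₉ : Integrable f₉ μ) {c₂ c₃ c₅ c₆ c₇ c₈ c₉ : ℝ} :
    ∫ x, (f₁ x - c₂ * f₂ x - c₃ * f₃ x - f₄ x - c₅ * f₅ x - c₆ * f₆ x + c₇ * f₇ x - c₈ * f₈ x +
      c₉ * f₉ x) ∂μ = ∫ x, f₁ x ∂μ - c₂ * ∫ x, f₂ x ∂μ - c₃ * ∫ x, f₃ x ∂μ - ∫ x, f₄ x ∂μ -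
      c₅ * ∫ x, f₅ x ∂μ - c₆ * ∫ x, f₆ x ∂μ + c₇ * ∫ x, f₇ x ∂μ - c₈ * ∫ x, f₈ x ∂μ +
      c₉ * ∫ x, f₉ x ∂μ := by
  rw [integral_add (by fun_prop) (by fun_prop), integral_sub (by fun_prop) (by fun_prop),
    integral_add (by fun_prop) (by fun_prop), integral_sub (by fun_prop) (by fun_prop),
    integral_sub (by fun_prop) (by fun_prop), integral_sub (by fun_prop) (by fun_prop),
    integral_sub (by fun_prop) (by fun_prop), integral_sub (by fun_prop) (by fun_prop)]
  simp only [integral_const_mul]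

lemma integrableOn_of_continuousOn {a b : ℝ} {f : ℝ → ℝ} (hf : ContinuousOn f (Icc a b)) :
    IntegrableOn f (Ioo a b) := hf.integrableOn_Icc.mono_set Ioo_subset_Icc_self

namespace IsProfile

variable {a b : ℝ} {u ux uxx uxxx : ℝ → ℝ} (h : IsProfile a b u ux uxx uxxx)
include h

lemma isOpen_posSet : IsOpen (posSet a b u) :=
  (h.continuousOn_u.mono Ioo_subset_Icc_self).isOpen_inter_preimage isOpen_Ioo isOpen_Ioi

lemma hasDerivAt_u {x : ℝ} (hx : x ∈ Ioo a b) : HasDerivAt u (ux x) x :=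
  h.weakDeriv_u.hasDerivAt_of_continuousOn isOpen_Ioo (h.continuousOn_u.mono Ioo_subset_Icc_self)
    (h.continuousOn_ux.mono Ioo_subset_Icc_self) hx

/-- A zero of the non-negative function `u` is an interior minimum. -/
lemma ux_eq_zero {x : ℝ} (hx : x ∈ Ioo a b) (hux : u x = 0) : ux x = 0 := by
  refine IsLocalMin.hasDerivAt_eq_zero ?_ (h.hasDerivAt_u hx)
  filter_upwards [isOpen_Ioo.mem_nhds hx] with y hy
  rw [hux]
  exact h.nonneg y (Ioo_subset_Icc_self hy)

lemma eq_zero_of_notMem {x : ℝ} (hx : x ∈ Ioo a b) (hxU : x ∉ posSet a b u) : u x = 0 :=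
  le_antisymm (not_lt.1 fun h' => hxU ⟨hx, h'⟩) (h.nonneg x (Ioo_subset_Icc_self hx))

lemma contDiffOn_ux : ContDiffOn ℝ 1 ux (posSet a b u) :=
  (h.weakDeriv_ux.contDiffOn_of_second h.weakDeriv_uxx h.isOpen_posSet
    (h.continuousOn_ux.mono fun _ hx => Ioo_subset_Icc_self hx.1)).1

lemma hasDerivAt_ux {x : ℝ} (hx : x ∈ posSet a b u) : HasDerivAt ux (deriv ux x) x :=
  ((h.contDiffOn_ux.differentiableOn one_ne_zero).differentiableAt
    (h.isOpen_posSet.mem_nhds hx)).hasDerivAt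

/-- The weak derivative `uxx` is determined only up to null sets; `deriv ux` is the continuous
version, which can be used in the product rule. -/
lemma ae_uxx_eq : ∀ᵐ x ∂volume.restrict (posSet a b u), uxx x = deriv ux x :=
  (h.weakDeriv_ux.contDiffOn_of_second h.weakDeriv_uxx h.isOpen_posSet
    (h.continuousOn_ux.mono fun _ hx => Ioo_subset_Icc_self hx.1)).2

lemma continuousOn_deriv_ux : ContinuousOn (deriv ux) (posSet a b u) :=
  h.contDiffOn_ux.continuousOn_deriv_of_isOpen h.isOpen_posSet le_rfl

lemma measurableSet_posSet : MeasurableSet (posSet a b u) := h.isOpen_posSet.measurableSet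

lemma aestronglyMeasurable_u : AEStronglyMeasurable u (volume.restrict (Ioo a b)) :=
  (h.continuousOn_u.mono Ioo_subset_Icc_self).aestronglyMeasurable measurableSet_Ioo

lemma aestronglyMeasurable_ux : AEStronglyMeasurable ux (volume.restrict (Ioo a b)) :=
  (h.continuousOn_ux.mono Ioo_subset_Icc_self).aestronglyMeasurable measurableSet_Ioo

lemma integrableOn_u_ux_uxx : IntegrableOn (fun x => u x * ux x * uxx x) (Ioo a b) := by
  have h2 : IntegrableOn (fun x => u x * ux x ^ 2) (Ioo a b) :=
    integrableOn_of_continuousOn (h.continuousOn_u.mul (h.continuousOn_ux.pow 2))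
  refine Integrable.mono' (h.integrable_entropy.add h2) ((h.aestronglyMeasurable_u.mul
    h.aestronglyMeasurable_ux).mul h.measurable_uxx.aestronglyMeasurable) ?_
  filter_upwards [ae_restrict_mem measurableSet_Ioo] with x hx
  have hu := h.nonneg x (Ioo_subset_Icc_self hx)
  simp only [Pi.add_apply]
  rw [Real.norm_eq_abs, abs_le]
  constructor <;> nlinarith [mul_nonneg hu (sq_nonneg (ux x + uxx x)),
    mul_nonneg hu (sq_nonneg (ux x - uxx x)), mul_nonneg hu (sq_nonneg (ux x)),
    mul_nonneg hu (sq_nonneg (uxx x))]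

/-- Zeros of `u` are also zeros of `uₓ`, so integrands with a factor `u` or `uₓ` live on the
positivity set, the only place where `uxx` and `uxxx` carry information. -/
lemma integral_posSet {F : ℝ → ℝ} (hF : ∀ x ∈ Ioo a b, u x = 0 → ux x = 0 → F x = 0) :
    ∫ x in Ioo a b, F x = ∫ x in posSet a b u, F x :=
  setIntegral_eq_of_subset_of_forall_sdiff_eq_zero measurableSet_Ioo (fun _ hx => hx.1)
    fun x hx => by
      have hu := h.eq_zero_of_notMem hx.1 hx.2
      exact hF x hx.1 hu (h.ux_eq_zero hx.1 hu)

/-- Integration of the derivative of `u (∂ₓu)² φ'`, which exists everywhere. -/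
lemma integral_deriv_u_ux_sq {φ : ℝ → ℝ} (hφ : IsTestFunction (Ioo a b) φ) :
    IntegrableOn (fun x => ux x ^ 3 * φ x + 2 * (u x * ux x * uxx x * φ x) +
      u x * ux x ^ 2 * deriv φ x) (Ioo a b) ∧
    ∫ x in posSet a b u, (ux x ^ 3 * φ x + 2 * (u x * ux x * deriv ux x * φ x) +
      u x * ux x ^ 2 * deriv φ x) = 0 := by
  set G' : ℝ → ℝ := fun x => ux x ^ 3 * φ x + 2 * (u x * ux x * deriv ux x * φ x) +
      u x * ux x ^ 2 * deriv φ x with hG'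
  obtain ⟨C, -, hC⟩ := hφ.exists_bound
  have hi : IntegrableOn (fun x => ux x ^ 3 * φ x + 2 * (u x * ux x * uxx x * φ x) +
      u x * ux x ^ 2 * deriv φ x) (Ioo a b) := by
    refine ((integrableOn_of_continuousOn ((h.continuousOn_ux.pow 3).mul
      hφ.continuous.continuousOn)).add (Integrable.const_mul ?_ 2)).add
      (integrableOn_of_continuousOn ((h.continuousOn_u.mul (h.continuousOn_ux.pow 2)).mul
        hφ.deriv.continuous.continuousOn))
    exact h.integrableOn_u_ux_uxx.mul_bdd hφ.continuous.aestronglyMeasurable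
      (Eventually.of_forall hC)
  have hzero : ∀ x ∈ Ioo a b, u x = 0 → ux x = 0 → G' x = 0 := fun x _ h1 h2 => by
    simp [hG', h1, h2]
  have hU : IntegrableOn G' (posSet a b u) := by
    refine (hi.mono_set fun x hx => hx.1).congr ?_
    filter_upwards [h.ae_uxx_eq] with x hx
    rw [hx]
  have hI : IntegrableOn G' (Ioo a b) := hU.of_forall_sdiff_eq_zero measurableSet_Ioo fun x hx => by
    have hu := h.eq_zero_of_notMem hx.1 hx.2
    exact hzero x hx.1 hu (h.ux_eq_zero hx.1 hu)
  have hout : ∀ x, x ∉ Ioo a b → G' x = 0 := fun x hx => by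
    simp [hG', hφ.eq_zero hx, hφ.deriv.eq_zero hx]
  have hIall : Integrable G' := by
    rw [← integrableOn_univ]
    exact hI.of_forall_sdiff_eq_zero MeasurableSet.univ fun x hx => hout x hx.2
  refine ⟨hi, ?_⟩
  rw [← h.integral_posSet hzero, setIntegral_eq_integral_of_forall_compl_eq_zero hout]
  refine integral_eq_zero_of_hasDerivAt_of_integrable (f := fun x => u x * (ux x ^ 2 * φ x))
    (fun x => ?_) hIall ?_
  · by_cases hx : x ∈ Ioo a b
    · by_cases hxU : x ∈ posSet a b u
      · have h1 := (h.hasDerivAt_u hx).mul (((h.hasDerivAt_ux hxU).pow 2).mul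
          ((hφ.1.differentiable (by simp) x).hasDerivAt))
        refine h1.congr_deriv ?_
        simp only [hG', Pi.mul_apply, Pi.pow_apply]
        norm_num
        ring
      -- At a zero of `u` also `uₓ = 0`, hence `u(y) = o(|y - x|)`. Multiplication by the continuous
      -- `uₓ² φ` keeps this order, so the product has derivative zero although `uₓ` need not be
      -- differentiable there. Thus no cut-off near the contact set is needed.
      · have hu := h.eq_zero_of_notMem hx hxU
        have hux := h.ux_eq_zero hx hu
        rw [hzero x hx hu hux]
        have hd := h.hasDerivAt_u hx
        rw [hux, hasDerivAt_iff_isLittleO] at hd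
        rw [hasDerivAt_iff_isLittleO]
        simp only [hu, sub_zero, smul_zero, zero_mul] at hd ⊢
        have hc : ContinuousAt (fun x => ux x ^ 2 * φ x) x :=
          ((h.continuousOn_ux.continuousAt (Icc_mem_nhds hx.1 hx.2)).pow 2).mul
            hφ.continuous.continuousAt
        simpa using hd.mul_isBigO (hc.tendsto.isBigO_one ℝ)
    · rw [hout x hx]
      have : (fun x => u x * (ux x ^ 2 * φ x)) =ᶠ[𝓝 x] fun _ => 0 := by
        filter_upwards [(isClosed_tsupport φ).isOpen_compl.mem_nhds
          (fun hx' => hx (hφ.2.2 hx'))] with y hy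
        rw [image_eq_zero_of_notMem_tsupport hy, mul_zero, mul_zero]
      exact (hasDerivAt_const x (0 : ℝ)).congr_of_eventuallyEq this
  · rw [← integrableOn_univ]
    exact IntegrableOn.of_forall_sdiff_eq_zero (integrableOn_of_continuousOn
      (h.continuousOn_u.mul ((h.continuousOn_ux.pow 2).mul hφ.continuous.continuousOn)))
      MeasurableSet.univ fun x hx => by simp [hφ.eq_zero hx.2]

/-- Take `K` to be the part of the support of `φ` where `u ≥ δ`. Since `H` and `H'` vanish on `[0,
δ]`, a factor `H(u)` or `H'(u)` together with `φ` or `φ'` gives compact support in the positivity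
set. -/
lemma exists_isCompact_superlevel {φ : ℝ → ℝ} (hφ : IsTestFunction (Ioo a b) φ) {δ : ℝ}
    (hδ : 0 < δ) : ∃ K, IsCompact K ∧ K ⊆ posSet a b u ∧
      ∀ x, x ∉ K → u x < δ ∨ x ∉ tsupport φ := by
  have hc : ContinuousOn u (tsupport φ) :=
    h.continuousOn_u.mono (hφ.2.2.trans Ioo_subset_Icc_self)
  refine ⟨tsupport φ ∩ u ⁻¹' Ici δ, ?_, fun x hx => ⟨hφ.2.2 hx.1, hδ.trans_le hx.2⟩, fun x hx => ?_⟩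
  · exact IsCompact.of_isClosed_subset hφ.2.1
      (hc.preimage_isClosed_of_isClosed (isClosed_tsupport φ) isClosed_Ici) inter_subset_left
  · by_contra! hcon
    exact hx ⟨hcon.2, hcon.1⟩

/-- The truncated form of the weak formula for `-u ∂ₓu ∂ₓₓₓu`. -/
lemma integral_truncated {φ : ℝ → ℝ} (hφ : IsTestFunction (Ioo a b) φ) {δ : ℝ} (hδ : 0 < δ)
    (hφ0 : ∀ x, 0 ≤ φ x)
    (hT : ∫ x in Ioo a b, -(u x * ux x * uxxx x) * φ x =
      (∫ x in Ioo a b, u x * uxx x ^ 2 * φ x) - 5 / 6 * (∫ x in Ioo a b, ux x ^ 3 * deriv φ x) -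
        1 / 2 * ∫ x in Ioo a b, u x * ux x ^ 2 * deriv (deriv φ) x) :
    - (∫ x in Ioo a b, smoothPart δ (u x) * ux x * uxxx x * φ x) +
      5 / 3 * (∫ x in Ioo a b, (u x - smoothPart δ (u x)) * ux x * uxx x * deriv φ x) +
      1 / 3 * (∫ x in Ioo a b, (u x - smoothPart δ (u x)) * ux x ^ 2 * deriv (deriv φ) x) ≤
      ∫ x in Ioo a b, -(u x * ux x * uxxx x) * φ x := by
  have hUI : posSet a b u ⊆ Ioo a b := fun x hx => hx.1
  have hUo := h.isOpen_posSet
  have hH0 : smoothPart δ 0 = 0 := smoothPart_eq_zero hδ hδ.le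
  obtain ⟨K, hK, hKU, hK0⟩ := h.exists_isCompact_superlevel hφ hδ
  have hφt : ∀ x, x ∉ tsupport φ → φ x = 0 := fun x hx => image_eq_zero_of_notMem_tsupport hx
  have hφt' : ∀ x, x ∉ tsupport φ → deriv φ x = 0 := fun x hx =>
    image_eq_zero_of_notMem_tsupport fun h' => hx (tsupport_deriv_subset h')
  have hdφ : ∀ x, HasDerivAt φ (deriv φ x) x := fun x =>
    (hφ.1.differentiable (by simp) x).hasDerivAt
  have hdφ' : ∀ x, HasDerivAt (deriv φ) (deriv (deriv φ) x) x := fun x =>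
    (hφ.deriv.1.differentiable (by simp) x).hasDerivAt
  have hdu : ∀ x ∈ posSet a b u, HasDerivAt u (ux x) x := fun x hx => h.hasDerivAt_u hx.1
  have cu : ContinuousOn u (posSet a b u) := h.continuousOn_u.mono (hUI.trans Ioo_subset_Icc_self)
  have cux : ContinuousOn ux (posSet a b u) := h.continuousOn_ux.mono (hUI.trans Ioo_subset_Icc_self)
  have cw := h.continuousOn_deriv_ux
  have cH : ContinuousOn (fun x => smoothPart δ (u x)) (posSet a b u) :=
    (continuous_smoothPart δ).comp_continuousOn cu
  have cH' : ContinuousOn (fun x => smoothSlope δ (u x)) (posSet a b u) :=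
    (contDiff_smoothSlope δ).continuous.comp_continuousOn cu
  have cH'' : ContinuousOn (fun x => deriv (smoothSlope δ) (u x)) (posSet a b u) :=
    (continuous_deriv_smoothSlope δ).comp_continuousOn cu
  have cφ : ContinuousOn φ (posSet a b u) := hφ.continuous.continuousOn
  have cφ' : ContinuousOn (deriv φ) (posSet a b u) := hφ.deriv.continuous.continuousOn
  have cφ'' : ContinuousOn (deriv (deriv φ)) (posSet a b u) := hφ.deriv.deriv.continuous.continuousOn
  have dH : ∀ x ∈ posSet a b u,
      HasDerivAt (fun x => smoothPart δ (u x)) (smoothSlope δ (u x) * ux x) x := fun x hx =>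
    (hasDerivAt_smoothPart δ (u x)).comp x (hdu x hx)
  have dH' : ∀ x ∈ posSet a b u, HasDerivAt (fun x => smoothSlope δ (u x))
      (deriv (smoothSlope δ) (u x) * ux x) x := fun x hx =>
    (hasDerivAt_smoothSlope δ (u x)).comp x (hdu x hx)
  have zK : ∀ x, x ∉ K → smoothPart δ (u x) * φ x = 0 ∧ smoothSlope δ (u x) * φ x = 0 ∧
      smoothPart δ (u x) * deriv φ x = 0 := fun x hx => by
    rcases hK0 x hx with h1 | h1
    · simp [smoothPart_eq_zero hδ h1.le, smoothSlope_eq_zero hδ h1.le]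
    · simp [hφt x h1, hφt' x h1]
  -- the pairing with the third derivative
  set F : ℝ → ℝ := fun x => ux x * (smoothPart δ (u x) * φ x) with hF
  set F' : ℝ → ℝ := fun x => deriv ux x * (smoothPart δ (u x) * φ x) + ux x *
    (smoothSlope δ (u x) * ux x * φ x + smoothPart δ (u x) * deriv φ x) with hF'
  obtain ⟨f1, f2, f3, f4, f5⟩ := contDiff_of_hasDerivAt_of_eq_zero hUo hK hKU (P := F) (P' := F')
    (fun x hx => (h.hasDerivAt_ux hx).mul ((dH x hx).mul (hdφ x)))
    ((cw.mul (cH.mul cφ)).add (cux.mul (((cH'.mul cux).mul cφ).add (cH.mul cφ'))))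
    (fun x hx => by simp only [hF]; rw [(zK x hx).1, mul_zero])
  have hpair := h.weakDeriv_uxx.integral_mul_deriv hUo f1 f2 f3
  have i4 : IntegrableOn (fun x => uxx x * deriv F x) (posSet a b u) := by
    refine IntegrableOn.of_forall_sdiff_eq_zero (s := K) ?_ h.measurableSet_posSet
      fun x hx => by rw [f5 x hx.2, mul_zero]
    exact (h.weakDeriv_uxx.1.integrableOn_compact_subset hKU hK).mul_continuousOn
      (f1.continuous_deriv le_rfl).continuousOn hK
  -- the two exact derivatives supported in the positivity set
  obtain ⟨i7, z7⟩ := integral_eq_zero_of_hasDerivAt_of_eq_zero hUo hK hKU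
    (P := fun x => ux x ^ 3 * (smoothSlope δ (u x) * φ x))
    (P' := fun x => 3 * ux x ^ 2 * deriv ux x * (smoothSlope δ (u x) * φ x) + ux x ^ 3 *
      (deriv (smoothSlope δ) (u x) * ux x * φ x + smoothSlope δ (u x) * deriv φ x))
    (fun x hx => by
      refine (((h.hasDerivAt_ux hx).pow 3).mul ((dH' x hx).mul (hdφ x))).congr_deriv ?_
      simp)
    (((continuousOn_const.mul (cux.pow 2)).mul cw |>.mul (cH'.mul cφ)).add
      ((cux.pow 3).mul (((cH''.mul cux).mul cφ).add (cH'.mul cφ'))))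
    (fun x hx => by rw [(zK x hx).2.1, mul_zero])
  obtain ⟨i8, z8⟩ := integral_eq_zero_of_hasDerivAt_of_eq_zero hUo hK hKU
    (P := fun x => ux x ^ 2 * (smoothPart δ (u x) * deriv φ x))
    (P' := fun x => 2 * ux x * deriv ux x * (smoothPart δ (u x) * deriv φ x) + ux x ^ 2 *
      (smoothSlope δ (u x) * ux x * deriv φ x + smoothPart δ (u x) * deriv (deriv φ) x))
    (fun x hx => by
      refine (((h.hasDerivAt_ux hx).pow 2).mul ((dH x hx).mul (hdφ' x))).congr_deriv ?_
      simp)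
    (((continuousOn_const.mul cux).mul cw |>.mul (cH.mul cφ')).add
      ((cux.pow 2).mul (((cH'.mul cux).mul cφ').add (cH.mul cφ''))))
    (fun x hx => by rw [(zK x hx).2.2, mul_zero])
  -- This identity is used with `φ'` in place of `φ`. It is the only exact derivative without a
  -- truncating factor, and so the only one that needs the argument at zeros of `u`.
  obtain ⟨i9, z9⟩ := h.integral_deriv_u_ux_sq hφ.deriv
  replace i9 : IntegrableOn (fun x => ux x ^ 3 * deriv φ x + 2 * (u x * ux x * deriv ux x * deriv φ x)
      + u x * ux x ^ 2 * deriv (deriv φ) x) (posSet a b u) := by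
    refine (i9.mono_set hUI).congr ?_
    filter_upwards [h.ae_uxx_eq] with x hx
    rw [hx]
  -- the remaining integrals
  obtain ⟨C, -, hC⟩ := hφ.exists_bound
  obtain ⟨C', -, hC'⟩ := hφ.deriv.exists_bound
  have i1 : IntegrableOn (fun x => u x * uxx x ^ 2 * φ x) (posSet a b u) :=
    IntegrableOn.mono_set (t := Ioo a b) (h.integrable_entropy.mul_bdd
      hφ.continuous.aestronglyMeasurable (Eventually.of_forall hC)) hUI
  have i2 : IntegrableOn (fun x => ux x ^ 3 * deriv φ x) (posSet a b u) :=
    (integrableOn_of_continuousOn ((h.continuousOn_ux.pow 3).mul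
      hφ.deriv.continuous.continuousOn)).mono_set hUI
  have i3 : IntegrableOn (fun x => u x * ux x ^ 2 * deriv (deriv φ) x) (posSet a b u) :=
    (integrableOn_of_continuousOn ((h.continuousOn_u.mul (h.continuousOn_ux.pow 2)).mul
      hφ.deriv.deriv.continuous.continuousOn)).mono_set hUI
  have hHm : AEStronglyMeasurable (fun x => smoothPart δ (u x)) (volume.restrict (Ioo a b)) :=
    (continuous_smoothPart δ).comp_aestronglyMeasurable h.aestronglyMeasurable_u
  have i5 : IntegrableOn (fun x => (u x - smoothPart δ (u x)) * ux x * uxx x * deriv φ x)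
      (posSet a b u) := by
    refine IntegrableOn.mono_set (t := Ioo a b) ?_ hUI
    refine Integrable.mul_bdd (c := C') ?_ hφ.deriv.continuous.aestronglyMeasurable
      (Eventually.of_forall hC')
    refine Integrable.mono h.integrableOn_u_ux_uxx (((h.aestronglyMeasurable_u.sub hHm).mul
      h.aestronglyMeasurable_ux).mul h.measurable_uxx.aestronglyMeasurable) ?_
    filter_upwards [ae_restrict_mem measurableSet_Ioo] with x hx
    have hu := h.nonneg x (Ioo_subset_Icc_self hx)
    rw [mul_assoc, mul_assoc, norm_mul, norm_mul (u x)]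
    gcongr
    rw [Real.norm_of_nonneg hu, Real.norm_of_nonneg (sub_nonneg.2 (smoothPart_le hu))]
    linarith [smoothPart_nonneg (δ := δ) hu]
  have i6 : IntegrableOn (fun x => (u x - smoothPart δ (u x)) * ux x ^ 2 * deriv (deriv φ) x)
      (posSet a b u) :=
    (integrableOn_of_continuousOn (((h.continuousOn_u.sub
      ((continuous_smoothPart δ).comp_continuousOn h.continuousOn_u)).mul
      (h.continuousOn_ux.pow 2)).mul hφ.deriv.deriv.continuous.continuousOn)).mono_set hUI
  -- Start from the weak formula for `T`, subtract the pairing of `uₓₓ` with the derivative of `uₓ H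
  -- φ` and the two error terms, and add multiples of the exact derivatives of `uₓ³ H' φ`, `uₓ² H
  -- φ'` and `u uₓ² φ'`. The coefficients are chosen so that every term with `φ'` or `φ''` cancels.
  -- What remains is `(u - H) uₓₓ² φ + 1/3 H'' uₓ⁴ φ`, which is non-negative since `H(u) ≤ u`, `H`
  -- is convex and `φ ≥ 0`.
  have hR : 0 ≤ ∫ x in posSet a b u,
      (u x * uxx x ^ 2 * φ x - 5 / 6 * (ux x ^ 3 * deriv φ x) -
        1 / 2 * (u x * ux x ^ 2 * deriv (deriv φ) x) - uxx x * deriv F x -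
        5 / 3 * ((u x - smoothPart δ (u x)) * ux x * uxx x * deriv φ x) -
        1 / 3 * ((u x - smoothPart δ (u x)) * ux x ^ 2 * deriv (deriv φ) x) +
        1 / 3 * (3 * ux x ^ 2 * deriv ux x * (smoothSlope δ (u x) * φ x) + ux x ^ 3 *
          (deriv (smoothSlope δ) (u x) * ux x * φ x + smoothSlope δ (u x) * deriv φ x)) -
        1 / 3 * (2 * ux x * deriv ux x * (smoothPart δ (u x) * deriv φ x) + ux x ^ 2 *
          (smoothSlope δ (u x) * ux x * deriv φ x + smoothPart δ (u x) * deriv (deriv φ) x)) +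
        5 / 6 * (ux x ^ 3 * deriv φ x + 2 * (u x * ux x * deriv ux x * deriv φ x) +
          u x * ux x ^ 2 * deriv (deriv φ) x)) := by
    refine integral_nonneg_of_ae ?_
    filter_upwards [h.ae_uxx_eq, ae_restrict_mem h.measurableSet_posSet] with x hx hxU
    rw [f4 x hxU, hF', hx]
    have hu := h.nonneg x (Ioo_subset_Icc_self hxU.1)
    have e1 : 0 ≤ (u x - smoothPart δ (u x)) * deriv ux x ^ 2 * φ x :=
      mul_nonneg (mul_nonneg (sub_nonneg.2 (smoothPart_le hu)) (sq_nonneg _)) (hφ0 x)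
    have e2 : 0 ≤ deriv (smoothSlope δ) (u x) * ux x ^ 4 * φ x :=
      mul_nonneg (mul_nonneg (deriv_smoothSlope_nonneg hδ) (by positivity)) (hφ0 x)
    simp only [Pi.zero_apply]
    nlinarith
  rw [integral_linear_combination_nine i1 i2 i3 i4 i5 i6 i7 i8 i9, z7, z8, z9] at hR
  have e4 : ∫ x in posSet a b u, uxx x * deriv F x =
      - ∫ x in Ioo a b, smoothPart δ (u x) * ux x * uxxx x * φ x := by
    rw [h.integral_posSet fun x _ hx _ => by rw [hx, hH0]; ring]
    refine hpair.trans ?_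
    rw [neg_inj]
    refine integral_congr_ae (Eventually.of_forall fun x => ?_)
    simp only [hF]
    ring
  rw [hT, h.integral_posSet (F := fun x => u x * uxx x ^ 2 * φ x) fun x _ hx _ => by rw [hx]; ring,
    h.integral_posSet (F := fun x => ux x ^ 3 * deriv φ x) fun x _ _ hx => by rw [hx]; ring,
    h.integral_posSet (F := fun x => u x * ux x ^ 2 * deriv (deriv φ) x)
      fun x _ hx _ => by rw [hx]; ring,
    h.integral_posSet (F := fun x => (u x - smoothPart δ (u x)) * ux x * uxx x * deriv φ x)
      fun x _ hx _ => by rw [hx, hH0]; ring,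
    h.integral_posSet (F := fun x => (u x - smoothPart δ (u x)) * ux x ^ 2 * deriv (deriv φ) x)
      fun x _ hx _ => by rw [hx, hH0]; ring]
  rw [e4] at hR
  linarith

end IsProfile

end Profile

/-! ### Quantitative lower bound for the source term -/

section Estimate

open Set

/-- No integrability is required: the Bochner integral of a non-integrable function is 0. One-sided
estimates in `ℝ≥0∞` thus avoid integrability checks on the error terms. -/
lemma ofReal_integral_le_lintegral_ofReal {α : Type*} [MeasurableSpace α] {μ : Measure α}
    {f g : α → ℝ} (h : ∀ᵐ x ∂μ, |f x| ≤ g x) :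
    ENNReal.ofReal (∫ x, f x ∂μ) ≤ ∫⁻ x, ENNReal.ofReal (g x) ∂μ := by
  refine (Real.ofReal_le_enorm _).trans ((enorm_integral_le_lintegral_enorm _).trans ?_)
  refine lintegral_mono_ae ?_
  filter_upwards [h] with x hx
  rw [← ofReal_norm]
  exact ENNReal.ofReal_le_ofReal hx

namespace IsProfile

variable {a b : ℝ} {u ux uxx uxxx : ℝ → ℝ} (h : IsProfile a b u ux uxx uxxx)
include h

/-- Quantitative lower bound for the pairing of `-u ∂ₓu ∂ₓₓₓu` with a non-negative test
function. -/
lemma ofReal_neg_integral_le {φ : ℝ → ℝ} (hφ : IsTestFunction (Ioo a b) φ)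
    (hφ0 : ∀ x, 0 ≤ φ x) {C κ l : ℝ} (hC0 : ∀ x, |φ x| ≤ C) (hC1 : ∀ x, |deriv φ x| ≤ C)
    (hC2 : ∀ x, |deriv (deriv φ) x| ≤ C) (hκ : 0 < κ) (hκ1 : κ ≤ 1) (hl : κ ^ 6 * l = 1)
    {m : ℝ → ℝ} (hm : ∀ x ∈ posSet a b u, u x ^ 3 ≤ m x)
    (hT : ∫ x in Ioo a b, -(u x * ux x * uxxx x) * φ x =
      (∫ x in Ioo a b, u x * uxx x ^ 2 * φ x) - 5 / 6 * (∫ x in Ioo a b, ux x ^ 3 * deriv φ x) -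
        1 / 2 * ∫ x in Ioo a b, u x * ux x ^ 2 * deriv (deriv φ) x) :
    ENNReal.ofReal (- ∫ x in Ioo a b, -(u x * ux x * uxxx x) * φ x) ≤
      ENNReal.ofReal (7 * C * κ) * ((∫⁻ x in Ioo a b, ENNReal.ofReal (u x * uxx x ^ 2)) +
        (∫⁻ x in Ioo a b, ENNReal.ofReal (1 / 2 * ux x ^ 2)) +
        ∫⁻ x in posSet a b u, ENNReal.ofReal (l * m x * uxxx x ^ 2)) := by
  have hC : 0 ≤ C := (abs_nonneg _).trans (hC0 0)
  -- The truncation level is `δ = κ²`.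
  have hδ : 0 < κ ^ 2 := by positivity
  have key := h.integral_truncated hφ hδ hφ0 hT
  set E := ∫⁻ x in Ioo a b, ENNReal.ofReal (u x * uxx x ^ 2)
  set G := ∫⁻ x in Ioo a b, ENNReal.ofReal (1 / 2 * ux x ^ 2) with hG
  set D := ∫⁻ x in posSet a b u, ENNReal.ofReal (l * m x * uxxx x ^ 2)
  have hUI : posSet a b u ⊆ Ioo a b := fun x hx => hx.1
  have hH0 : smoothPart (κ ^ 2) 0 = 0 := smoothPart_eq_zero hδ hδ.le
  have hpm : ∀ x ∈ Ioo a b, 0 ≤ u x ∧ 0 ≤ u x - smoothPart (κ ^ 2) (u x) ∧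
      u x - smoothPart (κ ^ 2) (u x) ≤ u x ∧ u x - smoothPart (κ ^ 2) (u x) ≤ 2 * κ ^ 2 := by
    intro x hx
    have hu := h.nonneg x (Ioo_subset_Icc_self hx)
    exact ⟨hu, sub_nonneg.2 (smoothPart_le hu), by linarith [smoothPart_nonneg (δ := κ ^ 2) hu],
      sub_smoothPart_le hδ hu⟩
  have hGm : AEMeasurable (fun x => ENNReal.ofReal (1 / 2 * ux x ^ 2))
      (volume.restrict (Ioo a b)) :=
    (((h.aestronglyMeasurable_ux.aemeasurable.pow_const 2).const_mul _)).ennreal_ofReal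
  have hsplit : ∀ {s : Set ℝ} {f g : ℝ → ℝ} {c d : ℝ}, s ⊆ Ioo a b → 0 ≤ c → 0 ≤ d →
      (∀ x ∈ s, 0 ≤ g x) →
      ∫⁻ x in s, ENNReal.ofReal (c * (1 / 2 * ux x ^ 2) + d * g x) ≤
        ENNReal.ofReal c * G + ENNReal.ofReal d * ∫⁻ x in s, ENNReal.ofReal (g x) := by
    intro s f g c d hs hc hd _
    calc ∫⁻ x in s, ENNReal.ofReal (c * (1 / 2 * ux x ^ 2) + d * g x)
        ≤ ∫⁻ x in s, (ENNReal.ofReal c * ENNReal.ofReal (1 / 2 * ux x ^ 2) +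
            ENNReal.ofReal d * ENNReal.ofReal (g x)) := by
          refine lintegral_mono fun x => ?_
          rw [← ENNReal.ofReal_mul hc, ← ENNReal.ofReal_mul hd]
          exact ENNReal.ofReal_add_le
      _ = ENNReal.ofReal c * (∫⁻ x in s, ENNReal.ofReal (1 / 2 * ux x ^ 2)) +
            ENNReal.ofReal d * ∫⁻ x in s, ENNReal.ofReal (g x) := by
          rw [lintegral_add_left' ((hGm.mono_set hs).const_mul _),
            lintegral_const_mul' _ _ ENNReal.ofReal_ne_top,
            lintegral_const_mul' _ _ ENNReal.ofReal_ne_top]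
      _ ≤ _ := by gcongr; exact lintegral_mono_set hs
  -- Error of the truncated part. Where `u > κ²`, one has `κ² u² uₓₓₓ² ≤ u³ uₓₓₓ² ≤ κ⁶ d`, with `d`
  -- the dissipation density; a Young inequality with `uₓ²` then gives a factor `κ`. The power six
  -- leaves room: the bound `κ⁴ d` already suffices.
  have hA : ENNReal.ofReal (∫ x in Ioo a b, smoothPart (κ ^ 2) (u x) * ux x * uxxx x * φ x) ≤
      ENNReal.ofReal (C * κ) * G + ENNReal.ofReal (C * κ) * D := by
    rw [h.integral_posSet fun x _ hx _ => by rw [hx, hH0]; ring]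
    have hlm : ∀ x ∈ posSet a b u, u x ^ 3 * uxxx x ^ 2 ≤ κ ^ 6 * (l * m x * uxxx x ^ 2) := by
      intro x hx
      have e : κ ^ 6 * (l * m x * uxxx x ^ 2) = m x * uxxx x ^ 2 := by
        linear_combination (m x * uxxx x ^ 2) * hl
      rw [e]
      exact mul_le_mul_of_nonneg_right (hm x hx) (sq_nonneg _)
    have hd0 : ∀ x ∈ posSet a b u, 0 ≤ l * m x * uxxx x ^ 2 := fun x hx => by
      have h1 := hlm x hx
      have h2 : 0 ≤ u x ^ 3 * uxxx x ^ 2 :=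
        mul_nonneg (pow_nonneg hx.2.le 3) (sq_nonneg _)
      exact nonneg_of_mul_nonneg_right (h2.trans h1) (by positivity)
    refine le_trans (ofReal_integral_le_lintegral_ofReal
      (g := fun x => C * κ * (1 / 2 * ux x ^ 2) + C * κ * (l * m x * uxxx x ^ 2)) ?_)
      (hsplit (f := u) hUI (by positivity) (by positivity) hd0)
    filter_upwards [ae_restrict_mem h.measurableSet_posSet] with x hx
    rw [abs_mul, mul_comm |_| |φ x|]
    have hrest : |smoothPart (κ ^ 2) (u x) * ux x * uxxx x| ≤
        κ * (1 / 2 * ux x ^ 2) + κ * (l * m x * uxxx x ^ 2) := by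
      have hdx := hd0 x hx
      rcases le_or_gt (u x) (κ ^ 2) with hle | hgt
      · rw [smoothPart_eq_zero hδ hle, zero_mul, zero_mul, abs_zero]
        positivity
      · have hu : 0 < u x := hx.2
        have h1 : |smoothPart (κ ^ 2) (u x) * ux x * uxxx x| ≤ u x * |ux x * uxxx x| := by
          rw [mul_assoc, abs_mul, abs_of_nonneg (smoothPart_nonneg hu.le)]
          exact mul_le_mul_of_nonneg_right (smoothPart_le hu.le) (abs_nonneg _)
        refine h1.trans ?_
        -- the square of the left-hand side is at most a product of the two summands
        have h2 : (u x * |ux x * uxxx x|) ^ 2 ≤ (κ * ux x ^ 2) * (κ * (l * m x * uxxx x ^ 2)) := by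
          have h3 : κ ^ 2 * (u x ^ 2 * uxxx x ^ 2) ≤ κ ^ 2 * (κ ^ 2 * (l * m x * uxxx x ^ 2)) := by
            calc κ ^ 2 * (u x ^ 2 * uxxx x ^ 2) ≤ u x * (u x ^ 2 * uxxx x ^ 2) := by gcongr
              _ = u x ^ 3 * uxxx x ^ 2 := by ring
              _ ≤ κ ^ 6 * (l * m x * uxxx x ^ 2) := hlm x hx
              _ ≤ κ ^ 4 * (l * m x * uxxx x ^ 2) :=
                mul_le_mul_of_nonneg_right
                  (pow_le_pow_of_le_one hκ.le hκ1 (by norm_num)) hdx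
              _ = _ := by ring
          have h4 := le_of_mul_le_mul_left h3 hδ
          rw [mul_pow, sq_abs, mul_pow]
          nlinarith [mul_le_mul_of_nonneg_left h4 (sq_nonneg (ux x))]
        refine abs_le_of_sq_le_sq' ?_ (by positivity) |>.2
        refine h2.trans ?_
        nlinarith [sq_nonneg (κ * (1 / 2 * ux x ^ 2) - κ * (l * m x * uxxx x ^ 2))]
    calc |φ x| * |smoothPart (κ ^ 2) (u x) * ux x * uxxx x|
        ≤ C * (κ * (1 / 2 * ux x ^ 2) + κ * (l * m x * uxxx x ^ 2)) :=
          mul_le_mul (hC0 x) hrest (abs_nonneg _) hC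
      _ = _ := by ring
  -- With `η = u - H(u)`, the bounds `η ≤ u` and `η ≤ 2κ²` combine to `η² ≤ 2κ² u`. This is what
  -- lets the weighted entropy density `u uₓₓ²` control `η uₓ uₓₓ`.
  have hB : ENNReal.ofReal (∫ x in Ioo a b, -(5 / 3 *
      ((u x - smoothPart (κ ^ 2) (u x)) * ux x * uxx x * deriv φ x))) ≤
      ENNReal.ofReal (4 * C * κ) * G + ENNReal.ofReal (C * κ) * E := by
    refine le_trans (ofReal_integral_le_lintegral_ofReal
      (g := fun x => 4 * C * κ * (1 / 2 * ux x ^ 2) + C * κ * (u x * uxx x ^ 2)) ?_)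
      (hsplit (f := u) le_rfl (by positivity) (by positivity)
        fun x hx => mul_nonneg (hpm x hx).1 (sq_nonneg _))
    filter_upwards [ae_restrict_mem measurableSet_Ioo] with x hx
    obtain ⟨hu, hh0, hhu, hhκ⟩ := hpm x hx
    set η := u x - smoothPart (κ ^ 2) (u x)
    have h1 : |η * ux x * uxx x| ≤ κ * ux x ^ 2 + 1 / 2 * κ * (u x * uxx x ^ 2) := by
      rw [mul_assoc, abs_mul, abs_of_nonneg hh0]
      refine abs_le_of_sq_le_sq' ?_ (by positivity) |>.2
      rw [mul_pow, sq_abs, mul_pow]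
      have h2 : η ^ 2 ≤ 2 * κ ^ 2 * u x := by nlinarith
      have h3 := mul_le_mul_of_nonneg_right h2 (mul_nonneg (sq_nonneg (ux x)) (sq_nonneg (uxx x)))
      nlinarith [sq_nonneg (κ * ux x ^ 2 - 1 / 2 * κ * (u x * uxx x ^ 2))]
    rw [abs_neg, abs_mul, abs_of_pos (by norm_num : (0 : ℝ) < 5 / 3), abs_mul]
    have h2 := mul_le_mul h1 (hC1 x) (abs_nonneg _) (by positivity)
    have h3 : 0 ≤ κ * ux x ^ 2 * C := by positivity
    have h4 : 0 ≤ κ * (u x * uxx x ^ 2) * C := by positivity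
    nlinarith
  -- Here `η ≤ 2κ² ≤ 2κ` suffices, and no second density appears; the trivial summand only fits the
  -- shape of `hsplit`.
  have hD : ENNReal.ofReal (∫ x in Ioo a b, -(1 / 3 *
      ((u x - smoothPart (κ ^ 2) (u x)) * ux x ^ 2 * deriv (deriv φ) x))) ≤
      ENNReal.ofReal (2 * C * κ) * G + ENNReal.ofReal 0 * ∫⁻ x in Ioo a b, ENNReal.ofReal 0 := by
    refine le_trans (ofReal_integral_le_lintegral_ofReal
      (g := fun x => 2 * C * κ * (1 / 2 * ux x ^ 2) + 0 * 0) ?_)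
      (hsplit (f := u) (g := fun _ => 0) le_rfl (by positivity) le_rfl fun _ _ => le_rfl)
    filter_upwards [ae_restrict_mem measurableSet_Ioo] with x hx
    obtain ⟨hu, hh0, hhu, hhκ⟩ := hpm x hx
    set η := u x - smoothPart (κ ^ 2) (u x)
    rw [abs_neg, abs_mul, abs_of_pos (by norm_num : (0 : ℝ) < 1 / 3), abs_mul,
      abs_of_nonneg (mul_nonneg hh0 (sq_nonneg _))]
    have h1 : η * ux x ^ 2 ≤ 2 * κ * ux x ^ 2 := by
      refine mul_le_mul_of_nonneg_right ?_ (sq_nonneg _)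
      nlinarith
    have h2 := mul_le_mul h1 (hC2 x) (abs_nonneg _) (by positivity)
    have h3 : 0 ≤ κ * ux x ^ 2 * C := by positivity
    nlinarith
  have hsum : - (∫ x in Ioo a b, -(u x * ux x * uxxx x) * φ x) ≤
      (∫ x in Ioo a b, smoothPart (κ ^ 2) (u x) * ux x * uxxx x * φ x) +
      (∫ x in Ioo a b, -(5 / 3 *
        ((u x - smoothPart (κ ^ 2) (u x)) * ux x * uxx x * deriv φ x))) +
      ∫ x in Ioo a b, -(1 / 3 *
        ((u x - smoothPart (κ ^ 2) (u x)) * ux x ^ 2 * deriv (deriv φ) x)) := by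
    rw [integral_neg, integral_neg, integral_const_mul, integral_const_mul]
    linarith
  -- The constant is `7 = 1 + 4 + 2`, the energy coefficients of the three errors; the entropy and
  -- the dissipation each occur with coefficient 1.
  have h7 : ENNReal.ofReal (7 * C * κ) * (E + G + D) = ENNReal.ofReal (7 * C * κ) * E +
      (ENNReal.ofReal (C * κ) + ENNReal.ofReal (4 * C * κ) + ENNReal.ofReal (2 * C * κ)) * G +
      ENNReal.ofReal (7 * C * κ) * D := by
    rw [← ENNReal.ofReal_add (by positivity) (by positivity),
      ← ENNReal.ofReal_add (by positivity) (by positivity),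
      show C * κ + 4 * C * κ + 2 * C * κ = 7 * C * κ by ring]
    ring
  have hle : ENNReal.ofReal (C * κ) ≤ ENNReal.ofReal (7 * C * κ) :=
    ENNReal.ofReal_le_ofReal (by nlinarith [mul_nonneg hC hκ.le])
  calc ENNReal.ofReal (- ∫ x in Ioo a b, -(u x * ux x * uxxx x) * φ x)
      ≤ (ENNReal.ofReal (C * κ) * G + ENNReal.ofReal (C * κ) * D) +
        (ENNReal.ofReal (4 * C * κ) * G + ENNReal.ofReal (C * κ) * E) +
        ENNReal.ofReal (2 * C * κ) * G := by
        refine (ENNReal.ofReal_le_ofReal hsum).trans (ENNReal.ofReal_add_le.trans ?_)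
        refine add_le_add (ENNReal.ofReal_add_le.trans (add_le_add hA hB)) ?_
        simpa using hD
    _ = ENNReal.ofReal (C * κ) * E +
      (ENNReal.ofReal (C * κ) + ENNReal.ofReal (4 * C * κ) + ENNReal.ofReal (2 * C * κ)) * G +
      ENNReal.ofReal (C * κ) * D := by ring
    _ ≤ _ := by rw [h7]; gcongr

end IsProfile

end Estimate

/-! ### Growth of `B` and the bound on the flux -/

section Entropy

open Set

/-- The inner integral in the definition of `B`. -/
noncomputable def tailIntegral (n r : ℝ) : ℝ := ∫ v in Ioi r, 1 / (v ^ (n - 1) + v ^ 2)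

lemma B_eq (n s : ℝ) : B n s = ∫ r in (0 : ℝ)..s, tailIntegral n r := rfl

variable {n : ℝ}

/-- An intermediate power is dominated by the lower one on `(0,1]` and by the higher one on `[1,∞)`.
The free exponent `m` yields decay rates of the tail integral for both large and small `r`. -/
lemma rpow_le_add_sq {m v : ℝ} (hv : 0 < v) (hnm : n - 1 ≤ m) (hm2 : m ≤ 2) :
    v ^ m ≤ v ^ (n - 1) + v ^ 2 := by
  have h1 : 0 < v ^ (n - 1) := Real.rpow_pos_of_pos hv _
  rcases le_total v 1 with h | h
  · have := Real.rpow_le_rpow_of_exponent_ge hv h hnm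
    nlinarith [sq_nonneg v]
  · have := Real.rpow_le_rpow_of_exponent_le h hm2
    rw [Real.rpow_two] at this
    linarith

lemma integrand_nonneg {v : ℝ} (hv : 0 < v) : 0 ≤ 1 / (v ^ (n - 1) + v ^ 2) := by
  have h1 : 0 < v ^ (n - 1) := Real.rpow_pos_of_pos hv _
  positivity

lemma integrand_le {m v : ℝ} (hv : 0 < v) (hnm : n - 1 ≤ m) (hm2 : m ≤ 2) :
    1 / (v ^ (n - 1) + v ^ 2) ≤ v ^ (-m) := by
  rw [Real.rpow_neg hv.le, ← one_div]
  exact one_div_le_one_div_of_le (Real.rpow_pos_of_pos hv _) (rpow_le_add_sq hv hnm hm2)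

lemma integrableOn_integrand (hn3 : n < 3) {r : ℝ} (hr : 0 < r) :
    IntegrableOn (fun v : ℝ => 1 / (v ^ (n - 1) + v ^ 2)) (Ioi r) := by
  refine Integrable.mono' (integrableOn_Ioi_rpow_of_lt (a := -2) (by norm_num) hr) ?_ ?_
  · exact (((measurable_id.pow_const _).add (measurable_id.pow_const _)).const_div
      1).aestronglyMeasurable
  · filter_upwards [ae_restrict_mem measurableSet_Ioi] with v hv
    have hv' := hr.trans hv
    rw [Real.norm_of_nonneg (integrand_nonneg hv')]
    exact integrand_le hv' (by linarith) le_rfl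

lemma tailIntegral_nonneg {r : ℝ} (hr : 0 ≤ r) : 0 ≤ tailIntegral n r :=
  setIntegral_nonneg measurableSet_Ioi fun _ hv => integrand_nonneg (hr.trans_lt hv)

lemma tailIntegral_le {m r : ℝ} (hn3 : n < 3) (hr : 0 < r) (hm : 1 < m) (hnm : n - 1 ≤ m)
    (hm2 : m ≤ 2) : tailIntegral n r ≤ r ^ (1 - m) / (m - 1) := by
  have h1 : ∫ v in Ioi r, v ^ (-m) = r ^ (1 - m) / (m - 1) := by
    rw [integral_Ioi_rpow_of_lt (by linarith) hr, show -m + 1 = 1 - m by ring,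
      show (1 - m) = -(m - 1) by ring, neg_div_neg_eq]
  rw [← h1]
  exact setIntegral_mono_on (integrableOn_integrand hn3 hr)
    (integrableOn_Ioi_rpow_of_lt (by linarith) hr) measurableSet_Ioi
    fun v hv => integrand_le (hr.trans hv) hnm hm2

lemma tailIntegral_le_inv {r : ℝ} (hn3 : n < 3) (hr : 0 < r) : tailIntegral n r ≤ 1 / r := by
  have := tailIntegral_le hn3 hr (m := 2) (by norm_num) (by linarith) le_rfl
  rwa [show (1 : ℝ) - 2 = -1 by norm_num, show (2 : ℝ) - 1 = 1 by norm_num, div_one,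
    Real.rpow_neg_one, ← one_div] at this

/-- The exponent `m = 1 + n/3` is admissible for every `n` in `(0,3)`, which avoids a case
distinction at `n = 2`. The rate `r^(-n/3)` is integrable at 0, and its square is still compensated
by `r^n`. -/
lemma tailIntegral_le_rpow {r : ℝ} (hn0 : 0 < n) (hn3 : n < 3) (hr : 0 < r) :
    tailIntegral n r ≤ 3 / n * r ^ (-(n / 3)) := by
  have := tailIntegral_le hn3 hr (m := 1 + n / 3) (by linarith) (by linarith) (by linarith)
  refine this.trans_eq ?_
  rw [show 1 - (1 + n / 3) = -(n / 3) by ring, show 1 + n / 3 - 1 = n / 3 by ring]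
  field_simp

lemma antitoneOn_tailIntegral (hn3 : n < 3) : AntitoneOn (tailIntegral n) (Ioi 0) :=
  fun _ hr _ _ hrs => setIntegral_mono_set (integrableOn_integrand hn3 hr)
    ((ae_restrict_iff' measurableSet_Ioi).2 (Eventually.of_forall fun _ hv =>
      integrand_nonneg (lt_trans (mem_Ioi.1 hr) hv))) (Ioi_subset_Ioi hrs).eventuallyLE

lemma intervalIntegrable_tailIntegral (hn0 : 0 < n) (hn3 : n < 3) {s t : ℝ} (hs : 0 ≤ s)
    (ht : 0 ≤ t) : IntervalIntegrable (tailIntegral n) volume s t := by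
  have h1 : IntervalIntegrable (fun r : ℝ => 3 / n * r ^ (-(n / 3))) volume s t :=
    (intervalIntegral.intervalIntegrable_rpow' (by linarith)).const_mul _
  rw [intervalIntegrable_iff] at h1 ⊢
  have hsub : uIoc s t ⊆ Ioi 0 := fun x hx => (le_min hs ht).trans_lt hx.1
  refine Integrable.mono' h1 ?_ ?_
  · exact (aemeasurable_restrict_of_antitoneOn measurableSet_uIoc
      ((antitoneOn_tailIntegral hn3).mono hsub)).aestronglyMeasurable
  · filter_upwards [ae_restrict_mem measurableSet_uIoc] with r hr
    have hr0 : 0 < r := hsub hr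
    rw [Real.norm_of_nonneg (tailIntegral_nonneg hr0.le)]
    exact tailIntegral_le_rpow hn0 hn3 hr0

lemma B_sub_B (hn0 : 0 < n) (hn3 : n < 3) {s t : ℝ} (hs : 0 ≤ s) (ht : 0 ≤ t) :
    B n t - B n s = ∫ r in s..t, tailIntegral n r :=
  intervalIntegral.integral_interval_sub_left (intervalIntegrable_tailIntegral hn0 hn3 le_rfl ht)
    (intervalIntegrable_tailIntegral hn0 hn3 le_rfl hs)

lemma monotoneOn_B (hn0 : 0 < n) (hn3 : n < 3) : MonotoneOn (B n) (Ici 0) :=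
  fun s hs t ht hst => by
    rw [← sub_nonneg, B_sub_B hn0 hn3 hs ht]
    exact intervalIntegral.integral_nonneg hst fun r hr => tailIntegral_nonneg (le_trans hs hr.1)

lemma B_zero : B n 0 = 0 := by rw [B_eq, intervalIntegral.integral_same]

lemma B_nonneg (hn0 : 0 < n) (hn3 : n < 3) {s : ℝ} (hs : 0 ≤ s) : 0 ≤ B n s := by
  rw [← B_zero (n := n)]
  exact monotoneOn_B hn0 hn3 (mem_Ici.2 le_rfl) hs hs

/-- The tail integral is at most `1/r`, whose primitive is the logarithm. The coefficient 1 of the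
logarithm is what makes the limit of `ρ^ε` at most 1. -/
lemma B_le (hn0 : 0 < n) (hn3 : n < 3) {s : ℝ} (hs : 1 ≤ s) : B n s ≤ B n 1 + Real.log s := by
  have h1 := B_sub_B hn0 hn3 zero_le_one (zero_le_one.trans hs)
  have h2 : ∫ r in (1 : ℝ)..s, tailIntegral n r ≤ ∫ r in (1 : ℝ)..s, 1 / r := by
    refine intervalIntegral.integral_mono_on hs
      (intervalIntegrable_tailIntegral hn0 hn3 zero_le_one (zero_le_one.trans hs)) ?_
      fun r hr => tailIntegral_le_inv hn3 (zero_lt_one.trans_le hr.1)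
    refine intervalIntegral.intervalIntegrable_one_div (fun r hr => ?_) continuousOn_id
    rw [uIcc_of_le hs] at hr
    exact (zero_lt_one.trans_le hr.1).ne'
  rw [integral_one_div_of_pos zero_lt_one (by linarith), div_one] at h2
  linarith

/-- The local Lipschitz constant of `B` on `(s/2, ∞)` is at most the tail integral at `s/2`, by
antitonicity. This bounds `deriv (B n) s` without proving differentiability, at the cost of harmless
factors of 2. -/
lemma abs_deriv_B_le (hn0 : 0 < n) (hn3 : n < 3) {s : ℝ} (hs : 0 < s) :
    |deriv (B n) s| ≤ tailIntegral n (s / 2) := by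
  rw [← Real.norm_eq_abs]
  refine norm_deriv_le_of_lip' (𝕜 := ℝ) (tailIntegral_nonneg (by positivity)) ?_
  filter_upwards [lt_mem_nhds (half_lt_self hs)] with x hx
  have hx0 : 0 < x := (half_pos hs).trans hx
  rw [B_sub_B hn0 hn3 hs.le hx0.le]
  refine intervalIntegral.norm_integral_le_of_norm_le_const fun r hr => ?_
  have hr' : s / 2 ≤ r := (le_min (half_lt_self hs).le hx.le).trans hr.1.le
  have hr0 : 0 < r := (half_pos hs).trans_le hr'
  rw [Real.norm_of_nonneg (tailIntegral_nonneg hr0.le)]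
  exact antitoneOn_tailIntegral hn3 (half_pos hs) hr0 hr'

/-- For `s ≥ 1` use `|B'| ≤ 2/s` and `s^n ≤ s³`, which give `8s`. For `s ≤ 1` use `|B'| ≤ (6/n)
s^(-n/3)`, so that `s^n B'² ≤ 36/n² · s^(n/3)`. -/
lemma rpow_mul_deriv_B_sq_le (hn0 : 0 < n) (hn3 : n < 3) {s : ℝ} (hs : 0 < s) :
    (s ^ n + s ^ 3) * deriv (B n) s ^ 2 ≤ (8 + 36 / n ^ 2) * (1 + s) := by
  have h0 := abs_deriv_B_le hn0 hn3 hs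
  have h1 := h0.trans (tailIntegral_le_inv hn3 (half_pos hs))
  have h2 := h0.trans (tailIntegral_le_rpow hn0 hn3 (half_pos hs))
  set β := |deriv (B n) s| with hβ
  have hβ0 : 0 ≤ β := abs_nonneg _
  rw [← sq_abs, ← hβ]
  have h3 : s ^ 3 * β ^ 2 ≤ 4 * s := by
    have : s * β ≤ 2 := by
      calc s * β ≤ s * (1 / (s / 2)) := by gcongr
        _ = 2 := by field_simp
    nlinarith [mul_le_mul this this (by positivity) (by norm_num), hs]
  have hn36 : 0 ≤ 36 / n ^ 2 := by positivity
  rcases le_total 1 s with h | h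
  · have : s ^ n ≤ s ^ 3 := by
      have := Real.rpow_le_rpow_of_exponent_le h hn3.le
      rwa [show (3 : ℝ) = ((3 : ℕ) : ℝ) by norm_num, Real.rpow_natCast] at this
    nlinarith [mul_le_mul_of_nonneg_right this (sq_nonneg β), mul_nonneg hn36 hs.le]
  · have h4 : s ^ n * β ^ 2 ≤ 36 / n ^ 2 := by
      have e1 : (s / 2) ^ (-(n / 3)) ≤ 2 * s ^ (-(n / 3)) := by
        rw [Real.div_rpow hs.le zero_le_two, div_eq_mul_inv, mul_comm,
          Real.rpow_neg zero_le_two, inv_inv]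
        refine mul_le_mul_of_nonneg_right ?_ (Real.rpow_nonneg hs.le _)
        calc (2 : ℝ) ^ (n / 3) ≤ 2 ^ (1 : ℝ) :=
              Real.rpow_le_rpow_of_exponent_le one_le_two (by linarith)
          _ = 2 := Real.rpow_one 2
      have e2 : β ≤ 6 / n * s ^ (-(n / 3)) := by
        refine h2.trans ?_
        calc 3 / n * (s / 2) ^ (-(n / 3)) ≤ 3 / n * (2 * s ^ (-(n / 3))) := by gcongr
          _ = 6 / n * s ^ (-(n / 3)) := by ring
      calc s ^ n * β ^ 2 ≤ s ^ n * (6 / n * s ^ (-(n / 3))) ^ 2 := by gcongr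
        _ = 36 / n ^ 2 * (s ^ n * (s ^ (-(n / 3)) * s ^ (-(n / 3)))) := by ring
        _ = 36 / n ^ 2 * s ^ (n / 3) := by
          rw [← Real.rpow_add hs, ← Real.rpow_add hs]
          congr 2
          ring
        _ ≤ 36 / n ^ 2 * 1 := by
          gcongr
          exact Real.rpow_le_one hs.le h (by positivity)
        _ = _ := mul_one _
    nlinarith [mul_nonneg hn36 hs.le]

variable {ε : ℝ}

lemma abs_log_pos (hε0 : 0 < ε) (hε1 : ε < 1) : 0 < |Real.log ε| :=
  abs_pos.2 (Real.log_neg hε0 hε1).ne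

lemma deriv_Beps (hε0 : 0 < ε) (s : ℝ) :
    deriv (Beps n ε) s = deriv (B n) (s / ε) / (ε * |Real.log ε|) := by
  have h1 : Beps n ε = fun s => B n (ε⁻¹ * s) / |Real.log ε| := by
    ext s; rw [Beps, div_eq_inv_mul s]
  rw [h1, deriv_div_const, deriv_comp_mul_left, smul_eq_mul, div_eq_inv_mul s]
  field_simp

/-- The flux `R^ε` is controlled by the dissipation. -/
lemma flux_sq_le (hn0 : 0 < n) (hn3 : n < 3) (hε0 : 0 < ε) (hε1 : ε < 1) {s M : ℝ} (hs : 0 < s)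
    (hsM : s ≤ M) (w : ℝ) :
    (|Real.log ε| * deriv (Beps n ε) s * (ε ^ (3 - n) * s ^ (n - 1) + s ^ 2) * s * w) ^ 2 *
      |Real.log ε| ≤ (8 + 36 / n ^ 2) * (1 + M) * (|Real.log ε| * mobility n ε s * w ^ 2) := by
  have hL := abs_log_pos hε0 hε1
  set L := |Real.log ε|
  set v := s / ε with hv
  have hv0 : 0 < v := div_pos hs hε0
  have hsv : s = ε * v := by rw [hv]; field_simp
  have hpow : ∀ m : ℝ, ε ^ (3 - n) * s ^ m = ε ^ (3 - n + m) * v ^ m := fun m => by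
    rw [hsv, Real.mul_rpow hε0.le hv0.le, Real.rpow_add hε0]; ring
  have e1 : ε ^ (3 - n) * s ^ (n - 1) = ε ^ 2 * v ^ (n - 1) := by
    rw [hpow, show 3 - n + (n - 1) = (2 : ℝ) by ring, Real.rpow_two]
  have e2 : mobility n ε s = ε ^ 3 * (v ^ n + v ^ 3) := by
    rw [mobility, hpow, show 3 - n + n = ((3 : ℕ) : ℝ) by push_cast; ring, Real.rpow_natCast, hsv]
    ring
  have e3 : v ^ n = v ^ (n - 1) * v := by
    rw [← Real.rpow_add_one hv0.ne']; congr 1; ring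
  rw [deriv_Beps hε0, ← hv, e1, e2]
  have key := rpow_mul_deriv_B_sq_le hn0 hn3 hv0
  set β := deriv (B n) v
  have hvn : 0 < v ^ n := Real.rpow_pos_of_pos hv0 _
  -- In the variable `v = s/ε` the factors `|ln ε|` cancel. The square splits into `ε (v^n + v³)
  -- B'(v)²`, bounded by the preceding lemma, times the mobility and `w²`.
  have e4 : L * (β / (ε * L)) * (ε ^ 2 * v ^ (n - 1) + s ^ 2) * s * w =
      ε ^ 2 * (v ^ n + v ^ 3) * β * w := by
    rw [e3, hsv]; field_simp
  rw [e4]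
  have hK : 0 ≤ 8 + 36 / n ^ 2 := by positivity
  calc (ε ^ 2 * (v ^ n + v ^ 3) * β * w) ^ 2 * L
      = (ε * ((v ^ n + v ^ 3) * β ^ 2)) * (L * (ε ^ 3 * (v ^ n + v ^ 3)) * w ^ 2) := by ring
    _ ≤ ((8 + 36 / n ^ 2) * (1 + M)) * (L * (ε ^ 3 * (v ^ n + v ^ 3)) * w ^ 2) := by
      refine mul_le_mul_of_nonneg_right ?_ (by positivity)
      calc ε * ((v ^ n + v ^ 3) * β ^ 2) ≤ ε * ((8 + 36 / n ^ 2) * (1 + v)) := by gcongr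
        _ = (8 + 36 / n ^ 2) * (ε + s) := by rw [hsv]; ring
        _ ≤ (8 + 36 / n ^ 2) * (1 + M) := by gcongr

lemma Beps_nonneg (hn0 : 0 < n) (hn3 : n < 3) (hε0 : 0 < ε) {s : ℝ} (hs : 0 ≤ s) :
    0 ≤ Beps n ε s := div_nonneg (B_nonneg hn0 hn3 (by positivity)) (abs_nonneg _)

/-- Since `log (M/ε) = log M + |ln ε|`, dividing by `|ln ε|` leaves 1 plus a term of order `1/|ln
ε|`. -/
lemma Beps_le (hn0 : 0 < n) (hn3 : n < 3) (hε0 : 0 < ε) (hε1 : ε < 1) {s M : ℝ} (hs : 0 ≤ s)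
    (hsM : s ≤ M) (hM : 1 ≤ M) :
    Beps n ε s ≤ 1 + (B n 1 + Real.log M) / |Real.log ε| := by
  have hL := abs_log_pos hε0 hε1
  have hM0 : 0 < M := by linarith
  have h1 : B n (s / ε) ≤ B n (M / ε) :=
    monotoneOn_B hn0 hn3 (mem_Ici.2 (by positivity)) (mem_Ici.2 (by positivity)) (by gcongr)
  have h2 := B_le hn0 hn3 (s := M / ε) (by rw [le_div_iff₀ hε0]; linarith)
  rw [Real.log_div hM0.ne' hε0.ne'] at h2
  have h3 : |Real.log ε| = - Real.log ε := abs_of_neg (Real.log_neg hε0 hε1)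
  rw [Beps, div_le_iff₀ hL, add_mul, div_mul_cancel₀ _ hL.ne']
  linarith

/-- A measurable function that agrees with `B^ε` on the half-line `[0,∞)`. -/
lemma measurable_Beps_max (hn0 : 0 < n) (hn3 : n < 3) (hε0 : 0 < ε) :
    Measurable fun s => Beps n ε (max s 0) := by
  refine Monotone.measurable fun s t hst => ?_
  refine div_le_div_of_nonneg_right ?_ (abs_nonneg _)
  refine monotoneOn_B hn0 hn3 (mem_Ici.2 ?_) (mem_Ici.2 ?_) ?_
  · positivity
  · positivity
  · gcongr

end Entropy

/-! ### Uniform bounds from mass, energy and entropy -/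

section SpaceTime

open Set

lemma ofReal_integral_le_lintegral_ofReal_self {α : Type*} [MeasurableSpace α] {μ : Measure α}
    (f : α → ℝ) : ENNReal.ofReal (∫ x, f x ∂μ) ≤ ∫⁻ x, ENNReal.ofReal (f x) ∂μ := by
  by_cases hf : Integrable f μ
  · rw [integral_eq_lintegral_pos_part_sub_lintegral_neg_part hf]
    exact (ENNReal.ofReal_le_ofReal (sub_le_self _ ENNReal.toReal_nonneg)).trans
      ENNReal.ofReal_toReal_le
  · simp [integral_undef hf]

/-- A bound for functions with prescribed mass and bounded energy. -/
noncomputable def heightBound (a b m e : ℝ) : ℝ := 1 + |m| / (b - a) + (b - a) / 2 + e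

lemma one_le_heightBound {a b m e : ℝ} (hab : a < b) (he : 0 ≤ e) : 1 ≤ heightBound a b m e := by
  have : 0 ≤ |m| / (b - a) := div_nonneg (abs_nonneg _) (by linarith)
  unfold heightBound
  linarith

lemma IsProfile.le_heightBound {a b : ℝ} {u ux uxx uxxx : ℝ → ℝ}
    (h : IsProfile a b u ux uxx uxxx) (hab : a < b) {m e : ℝ} (he : 0 ≤ e)
    (hm : ∫ x in Ioo a b, u x = m)
    (hE : ∫⁻ x in Ioo a b, ENNReal.ofReal (1 / 2 * ux x ^ 2) ≤ ENNReal.ofReal e)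
    {x : ℝ} (hx : x ∈ Ioo a b) : u x ≤ heightBound a b m e := by
  have hba : 0 < b - a := by linarith
  have hvol : volume.real (Ioo a b) = b - a := by simp [Measure.real, hba.le]
  have hui : IntegrableOn u (Ioo a b) := integrableOn_of_continuousOn h.continuousOn_u
  have hsq : IntegrableOn (fun x => 1 / 2 * ux x ^ 2) (Ioo a b) :=
    integrableOn_of_continuousOn (continuousOn_const.mul (h.continuousOn_ux.pow 2))
  have hsq_le : ∫ x in Ioo a b, 1 / 2 * ux x ^ 2 ≤ e := by
    have := ofReal_integral_eq_lintegral_ofReal hsq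
      (Eventually.of_forall fun x => by positivity)
    rw [← this] at hE
    exact (ENNReal.ofReal_le_ofReal_iff he).1 hE
  -- Some value of `u` does not exceed the mean. From this point the oscillation is at most `∫ |uₓ|
  -- ≤ ∫ (1/2 + uₓ²/2)`; the extra 1 in `heightBound` serves only to make it at least 1.
  obtain ⟨x₀, hx₀, hle⟩ : ∃ x₀ ∈ Ioo a b, u x₀ ≤ |m| / (b - a) := by
    by_contra! hcon
    have h1 : ∫ x in Ioo a b, |m| / (b - a) ≤ ∫ x in Ioo a b, u x :=
      setIntegral_mono_on (by simp) hui measurableSet_Ioo fun x hx => (hcon x hx).le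
    rw [setIntegral_const, hvol, smul_eq_mul, mul_div_cancel₀ _ hba.ne', hm] at h1
    have h2 : ∫ x in Ioo a b, (u x - |m| / (b - a)) = 0 := by
      rw [integral_sub hui (by simp), setIntegral_const, hvol, smul_eq_mul,
        mul_div_cancel₀ _ hba.ne', hm]
      linarith [le_abs_self m]
    have h3 := (setIntegral_eq_zero_iff_of_nonneg_ae (s := Ioo a b)
      ((ae_restrict_iff' measurableSet_Ioo).2 (Eventually.of_forall fun x hx =>
        sub_nonneg.2 (hcon x hx).le)) (hui.sub (by simp))).1 h2
    have h4 : ∀ᵐ x ∂volume.restrict (Ioo a b), False := by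
      filter_upwards [h3, ae_restrict_mem measurableSet_Ioo] with x hx hxI
      have := hcon x hxI
      simp only [Pi.zero_apply] at hx
      linarith
    rw [eventually_false_iff_eq_bot, ae_eq_bot, Measure.restrict_eq_zero] at h4
    simp [hab.not_ge] at h4
  have hsub : uIcc x₀ x ⊆ Ioo a b := ordConnected_Ioo.uIcc_subset hx₀ hx
  have hint : IntervalIntegrable ux volume x₀ x :=
    ((h.continuousOn_ux.mono Ioo_subset_Icc_self).mono hsub).intervalIntegrable
  have hftc : u x - u x₀ = ∫ y in x₀..x, ux y :=
    (intervalIntegral.integral_eq_sub_of_hasDerivAt (fun y hy => h.hasDerivAt_u (hsub hy)) hint).symm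
  have habs : |∫ y in x₀..x, ux y| ≤ ∫ y in Ioo a b, (1 / 2 + 1 / 2 * ux y ^ 2) := by
    rw [← Real.norm_eq_abs]
    refine intervalIntegral.norm_integral_le_integral_norm_uIoc.trans ?_
    have hsub' : uIoc x₀ x ⊆ Ioo a b := uIoc_subset_uIcc.trans hsub
    have hg : IntegrableOn (fun y => 1 / 2 + 1 / 2 * ux y ^ 2) (Ioo a b) :=
      Integrable.add (by simp) hsq
    refine le_trans (setIntegral_mono_on (intervalIntegrable_iff.1 hint).norm
      (hg.mono_set hsub') measurableSet_uIoc fun y _ => ?_)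
      (setIntegral_mono_set hg (Eventually.of_forall fun y => by positivity) hsub'.eventuallyLE)
    rw [Real.norm_eq_abs, ← sq_abs]
    nlinarith [sq_nonneg (|ux y| - 1)]
  rw [integral_add (by simp) hsq, setIntegral_const, hvol, smul_eq_mul] at habs
  have := le_abs_self (∫ y in x₀..x, ux y)
  unfold heightBound
  linarith

lemma pow_three_le_mobility {n ε : ℝ} (hε0 : 0 < ε) {s : ℝ} (hs : 0 < s) : s ^ 3 ≤ mobility n ε s := by
  have : 0 ≤ ε ^ (3 - n) * s ^ n := by positivity
  unfold mobility
  linarith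

namespace Solution

variable {n a b : ℝ} {uin uin' : ℝ → ℝ} {ε : ℝ} (S : Solution n a b uin uin' ε)
include S

lemma measurable_entropyDensity :
    Measurable fun s => ∫⁻ x in Ioo a b, ENNReal.ofReal (S.u s x * S.uxx s x ^ 2) :=
  Measurable.lintegral_prod_right'
    (f := fun z : ℝ × ℝ => ENNReal.ofReal (S.u z.1 z.2 * S.uxx z.1 z.2 ^ 2))
    (S.measurable_u.mul (S.measurable_uxx.pow_const 2)).ennreal_ofReal

lemma measurable_energy :
    Measurable fun s => ∫⁻ x in Ioo a b, ENNReal.ofReal (1 / 2 * S.ux s x ^ 2) :=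
  Measurable.lintegral_prod_right'
    (f := fun z : ℝ × ℝ => ENNReal.ofReal (1 / 2 * S.ux z.1 z.2 ^ 2))
    ((S.measurable_ux.pow_const 2).const_mul _).ennreal_ofReal

/-- The space-time bounds on `u uₓₓ²` and `u uₓₓₓ` become integrability on almost every slice by
Fubini. -/
lemma ae_isProfile (T : ℝ) : ∀ᵐ t ∂volume.restrict (Ioo 0 T),
    IsProfile a b (S.u t) (S.ux t) (S.uxx t) (S.uxxx t) := by
  rcases le_or_gt T 0 with hT | hT
  · simp [Ioo_eq_empty_of_le hT]
  have hsub : Ioo 0 T ⊆ Ioi 0 := fun t ht => ht.1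
  have hE := ae_lt_top S.measurable_entropyDensity (μ := volume.restrict (Ioo 0 T))
    ((le_self_add.trans (S.entropy T hT)).trans_lt ENNReal.ofReal_lt_top).ne
  have h3 : ∀ᵐ t ∂volume.restrict (Ioo 0 T),
      Integrable (fun x => S.u t x * S.uxxx t x) (volume.restrict (Ioo a b)) := by
    have h1 := S.memLp_u_uxxx T
    rw [Measure.volume_eq_prod, ← Measure.prod_restrict] at h1
    exact (h1.integrable one_le_two).prod_right_ae
  filter_upwards [hE, h3, ae_restrict_of_ae_restrict_of_subset hsub S.boundary,
    ae_restrict_of_ae_restrict_of_subset hsub S.weakDeriv_ux,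
    ae_restrict_of_ae_restrict_of_subset hsub S.weakDeriv_uxx,
    ae_restrict_mem measurableSet_Ioo] with t hE h3 hb h4 h5 ht
  refine ⟨S.continuousOn_u t ht.1, S.nonneg t ht.1, S.weakDeriv_u t ht.1, hb.1, h4, h5,
    S.measurable_uxx.of_uncurry_left, S.measurable_uxxx.of_uncurry_left, ?_, h3⟩
  refine (lintegral_ofReal_ne_top_iff_integrable ?_ ?_).1 hE.ne
  · exact (S.measurable_u.of_uncurry_left.mul
      (S.measurable_uxx.of_uncurry_left.pow_const 2)).aestronglyMeasurable
  · filter_upwards [ae_restrict_mem measurableSet_Ioo] with x hx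
    exact mul_nonneg (S.nonneg t ht.1 x (Ioo_subset_Icc_self hx)) (sq_nonneg _)

lemma ae_u_le (hab : a < b) {e : ℝ} (he : 0 ≤ e)
    (hE : ∫⁻ x in Ioo a b, ENNReal.ofReal (1 / 2 * uin' x ^ 2) ≤ ENNReal.ofReal e) (T : ℝ) :
    ∀ᵐ t ∂volume.restrict (Ioo 0 T), ∀ x ∈ Ioo a b,
      S.u t x ≤ heightBound a b (∫ x in Ioo a b, uin x) e := by
  filter_upwards [S.ae_isProfile T, ae_restrict_mem measurableSet_Ioo] with t h ht x hx
  exact h.le_heightBound hab he (S.mass t ht.1)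
    ((le_self_add.trans (S.energy t ht.1)).trans hE) hx

lemma ae_rho_mem (hn0 : 0 < n) (hn3 : n < 3) (hε0 : 0 < ε) (hε1 : ε < 1) (hab : a < b) {e : ℝ}
    (he : 0 ≤ e)
    (hE : ∫⁻ x in Ioo a b, ENNReal.ofReal (1 / 2 * uin' x ^ 2) ≤ ENNReal.ofReal e) (T : ℝ) :
    ∀ᵐ t ∂volume.restrict (Ioo 0 T), ∀ x ∈ Ioo a b, 0 ≤ S.rho t x ∧ S.rho t x ≤
      1 + (B n 1 + Real.log (heightBound a b (∫ x in Ioo a b, uin x) e)) / |Real.log ε| := by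
  filter_upwards [S.ae_u_le hab he hE T, ae_restrict_mem measurableSet_Ioo] with t h ht x hx
  have hu := S.nonneg t ht.1 x (Ioo_subset_Icc_self hx)
  exact ⟨Beps_nonneg hn0 hn3 hε0 hu,
    Beps_le hn0 hn3 hε0 hε1 hu (h x hx) (one_le_heightBound hab he)⟩

/-- The entropy inequality bounds the production of `u uₓₓ²` by `∫ ρ^ε`, and `ρ^ε` is bounded above
uniformly for small `ε`. -/
lemma lintegral_entropy_le (hn0 : 0 < n) (hn3 : n < 3) (hε0 : 0 < ε) (hε1 : ε < 1) (hab : a < b)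
    {e : ℝ} (he : 0 ≤ e)
    (hE : ∫⁻ x in Ioo a b, ENNReal.ofReal (1 / 2 * uin' x ^ 2) ≤ ENNReal.ofReal e) {T : ℝ}
    (hT : 0 < T) :
    ∫⁻ s in Ioo 0 T, ∫⁻ x in Ioo a b, ENNReal.ofReal (S.u s x * S.uxx s x ^ 2) ≤
      ENNReal.ofReal ((b - a) * (1 + (B n 1 +
        Real.log (heightBound a b (∫ x in Ioo a b, uin x) e)) / |Real.log ε|)) := by
  set ρmax := 1 + (B n 1 + Real.log (heightBound a b (∫ x in Ioo a b, uin x) e)) / |Real.log ε|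
  -- The bound on `ρ^ε` is known only for almost every time, so the entropy inequality is used at
  -- some good time after `T`.
  obtain ⟨t, ht, htρ⟩ : ∃ t, T < t ∧ ∀ x ∈ Ioo a b, 0 ≤ S.rho t x ∧ S.rho t x ≤ ρmax := by
    by_contra! hcon
    have h1 := S.ae_rho_mem hn0 hn3 hε0 hε1 hab he hE (T + 1)
    have h2 : ∀ᵐ t ∂volume.restrict (Ioo T (T + 1)), False := by
      filter_upwards [ae_restrict_of_ae_restrict_of_subset
        (Ioo_subset_Ioo_left hT.le) h1, ae_restrict_mem measurableSet_Ioo] with t h1 ht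
      obtain ⟨x, hx, h3⟩ := hcon t ht.1
      exact absurd (h1 x hx).2 (not_le.2 (h3 (h1 x hx).1))
    rw [eventually_false_iff_eq_bot, ae_eq_bot, Measure.restrict_eq_zero] at h2
    simp at h2
  refine (lintegral_mono_set (Ioo_subset_Ioo_right ht.le)).trans
    ((le_self_add.trans (S.entropy t (hT.trans ht))).trans (ENNReal.ofReal_le_ofReal ?_))
  by_cases hi : IntegrableOn (S.rho t) (Ioo a b)
  · have := setIntegral_mono_on hi (integrableOn_const (C := ρmax) (by simp) (by simp))
      measurableSet_Ioo fun x hx => (htρ x hx).2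
    rwa [setIntegral_const, Measure.real, Real.volume_Ioo,
      ENNReal.toReal_ofReal (by linarith), smul_eq_mul] at this
  · rw [integral_undef hi]
    have hmid : (a + b) / 2 ∈ Ioo a b := ⟨by linarith, by linarith⟩
    have := htρ _ hmid
    exact mul_nonneg (by linarith) (this.1.trans this.2)

lemma lintegral_energy_le {T : ℝ} :
    ∫⁻ s in Ioo 0 T, ∫⁻ x in Ioo a b, ENNReal.ofReal (1 / 2 * S.ux s x ^ 2) ≤
      (∫⁻ x in Ioo a b, ENNReal.ofReal (1 / 2 * uin' x ^ 2)) * ENNReal.ofReal T := by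
  refine (setLIntegral_mono' measurableSet_Ioo
    fun s hs => le_self_add.trans (S.energy s hs.1)).trans ?_
  rw [lintegral_const, Measure.restrict_apply_univ, Real.volume_Ioo, sub_zero]

lemma lintegral_dissipation_le {T : ℝ} (hT : 0 < T) :
    ∫⁻ s in Ioo 0 T, ∫⁻ x in posSet a b (S.u s),
        ENNReal.ofReal (|Real.log ε| * mobility n ε (S.u s x) * S.uxxx s x ^ 2) ≤
      ∫⁻ x in Ioo a b, ENNReal.ofReal (1 / 2 * uin' x ^ 2) :=
  le_add_self.trans (S.energy T hT)

end Solution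

end SpaceTime

/-! ### Almost monotonicity of `ρ^ε` against non-negative test functions -/

section Monotonicity

open Set

lemma isTestFunction_tensor {χ φ : ℝ → ℝ} {s t : Set ℝ} (hχ : IsTestFunction s χ)
    (hφ : IsTestFunction t φ) :
    IsTestFunction (s ×ˢ t) fun z : ℝ × ℝ => χ z.1 * φ z.2 := by
  have hK : IsCompact (tsupport χ ×ˢ tsupport φ) := hχ.2.1.prod hφ.2.1
  have h0 : ∀ z : ℝ × ℝ, z ∉ tsupport χ ×ˢ tsupport φ → χ z.1 * φ z.2 = 0 := fun z hz => by
    rw [mem_prod, not_and_or] at hz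
    rcases hz with hz | hz <;> simp [image_eq_zero_of_notMem_tsupport hz]
  refine ⟨(hχ.1.comp contDiff_fst).mul (hφ.1.comp contDiff_snd), HasCompactSupport.intro hK h0, ?_⟩
  exact (closure_minimal (fun z hz => by_contra fun h => (Function.mem_support.1 hz) (h0 z h))
    hK.isClosed).trans (prod_mono hχ.2.2 hφ.2.2)

namespace Solution

variable {n a b : ℝ} {uin uin' : ℝ → ℝ} {ε : ℝ} (S : Solution n a b uin uin' ε)
include S

/-- The equation for `ρ^ε` tested with a product of functions of `t` and of `x`. -/
lemma rho_equation_tensor {T : ℝ} {χ φ : ℝ → ℝ} (hχ : IsTestFunction (Ioo 0 T) χ)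
    (hφ : IsTestFunction (Ioo a b) φ) :
    ∫ t in Ioo 0 T, deriv χ t * ∫ x in Ioo a b, S.rho t x * φ x =
      (∫ t in Ioo 0 T, χ t * -∫ x in Ioo a b, S.T t x * φ x) +
        ∫ t in Ioo 0 T, χ t * ∫ x in Ioo a b, S.R t x * deriv φ x := by
  have hsub : Ioo 0 T ⊆ Ioi 0 := fun t ht => ht.1
  have h := S.rho_equation _
    (IsTestFunction.mono (isTestFunction_tensor hχ hφ) (prod_mono hsub le_rfl))
  simp only [deriv_mul_const_field, deriv_const_mul_field] at h
  have e1 : ∀ t, ∫ x in Ioo a b, S.rho t x * (deriv χ t * φ x) =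
      deriv χ t * ∫ x in Ioo a b, S.rho t x * φ x := fun t => by
    rw [← integral_const_mul]; congr 1; ext x; ring
  have e2 : ∀ t, ∫ x in Ioo a b, S.T t x * (χ t * φ x) =
      χ t * ∫ x in Ioo a b, S.T t x * φ x := fun t => by
    rw [← integral_const_mul]; congr 1; ext x; ring
  have e3 : ∀ t, ∫ x in Ioo a b, S.R t x * (χ t * deriv φ x) =
      χ t * ∫ x in Ioo a b, S.R t x * deriv φ x := fun t => by
    rw [← integral_const_mul]; congr 1; ext x; ring
  simp only [e1, e2, e3] at h
  have hres : ∀ {g k : ℝ → ℝ}, (∀ t, t ∉ Ioo 0 T → g t = 0) →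
      ∫ t in Ioi 0, g t * k t = ∫ t in Ioo 0 T, g t * k t := fun hg =>
    setIntegral_eq_of_subset_of_forall_sdiff_eq_zero measurableSet_Ioi hsub fun t ht => by
      rw [hg t ht.2, zero_mul]
  rw [hres fun t ht => hχ.deriv.eq_zero ht, hres fun t ht => hχ.eq_zero ht,
    hres fun t ht => hχ.eq_zero ht] at h
  simp only [mul_neg]
  rw [integral_neg]
  linarith

/-- The limit equation holds with a sign, up to an error that vanishes as `ε → 0`. -/
lemma ofReal_integral_deriv_mul_rho_le (hn0 : 0 < n) (hn3 : n < 3) (hε0 : 0 < ε) (hε1 : ε < 1)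
    (hab : a < b) {e : ℝ} (he : 0 ≤ e)
    (hE : ∫⁻ x in Ioo a b, ENNReal.ofReal (1 / 2 * uin' x ^ 2) ≤ ENNReal.ofReal e)
    {T : ℝ} (hT : 0 < T) {χ φ : ℝ → ℝ} (hχ : IsTestFunction (Ioo 0 T) χ) (hχ0 : ∀ t, 0 ≤ χ t)
    (hφ : IsTestFunction (Ioo a b) φ) (hφ0 : ∀ x, 0 ≤ φ x) {Cχ C κ : ℝ} (hCχ : ∀ t, χ t ≤ Cχ)
    (hC0 : ∀ x, |φ x| ≤ C) (hC1 : ∀ x, |deriv φ x| ≤ C) (hC2 : ∀ x, |deriv (deriv φ) x| ≤ C)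
    (hκ : 0 < κ) (hκ1 : κ ≤ 1) (hl : κ ^ 6 * |Real.log ε| = 1) {M : ℝ}
    (hM : M = heightBound a b (∫ x in Ioo a b, uin x) e) :
    ENNReal.ofReal (∫ t in Ioo 0 T, deriv χ t * ∫ x in Ioo a b, S.rho t x * φ x) ≤
      ENNReal.ofReal (7 * Cχ * C * κ) * ((ENNReal.ofReal ((b - a) * (1 + (B n 1 + Real.log M))) +
        ENNReal.ofReal e * ENNReal.ofReal T + ENNReal.ofReal e) +
        (ENNReal.ofReal ((8 + 36 / n ^ 2) * (1 + M) * (b - a)) * ENNReal.ofReal T +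
          ENNReal.ofReal e)) := by
  have hC : 0 ≤ C := (abs_nonneg _).trans (hC0 0)
  have hCχ0 : 0 ≤ Cχ := (hχ0 0).trans (hCχ 0)
  have hL := abs_log_pos hε0 hε1
  -- Since `κ ≤ 1`, this makes the bound on `ρ^ε` uniform: `1/|ln ε|` can be replaced by 1.
  have hL1 : 1 ≤ |Real.log ε| := by
    have : κ ^ 6 ≤ 1 := pow_le_one₀ hκ.le hκ1
    nlinarith
  have hM1 : 1 ≤ M := hM ▸ one_le_heightBound hab he
  have hB1 : 0 ≤ B n 1 + Real.log M := add_nonneg (B_nonneg hn0 hn3 zero_le_one) (Real.log_nonneg hM1)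
  set D : ℝ → ℝ≥0∞ := fun s => ∫⁻ x in posSet a b (S.u s),
    ENNReal.ofReal (|Real.log ε| * mobility n ε (S.u s x) * S.uxxx s x ^ 2) with hD
  set K := (8 + 36 / n ^ 2) * (1 + M) with hK
  have hK0 : 0 ≤ K := by positivity
  have hEtot := S.lintegral_entropy_le hn0 hn3 hε0 hε1 hab he hE hT
  have hGtot := (S.lintegral_energy_le (T := T)).trans (mul_le_mul_left hE _)
  have hDtot := (S.lintegral_dissipation_le hT).trans hE
  rw [S.rho_equation_tensor hχ hφ]
  refine ENNReal.ofReal_add_le.trans ?_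
  rw [mul_add]
  refine add_le_add ?_ ?_
  · refine (ofReal_integral_le_lintegral_ofReal_self _).trans ?_
    have hsub : Ioo 0 T ⊆ Ioi 0 := fun t ht => ht.1
    have hpt : ∀ᵐ t ∂volume.restrict (Ioo 0 T),
        ENNReal.ofReal (χ t * -∫ x in Ioo a b, S.T t x * φ x) ≤
          ENNReal.ofReal (7 * Cχ * C * κ) *
          ((∫⁻ x in Ioo a b, ENNReal.ofReal (S.u t x * S.uxx t x ^ 2)) +
            (∫⁻ x in Ioo a b, ENNReal.ofReal (1 / 2 * S.ux t x ^ 2)) + D t) := by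
      filter_upwards [S.ae_isProfile T, ae_restrict_of_ae_restrict_of_subset hsub S.T_formula]
        with t hprof hTf
      have := hprof.ofReal_neg_integral_le hφ hφ0 hC0 hC1 hC2 hκ hκ1 hl
        (m := fun x => mobility n ε (S.u t x)) (fun x hx => pow_three_le_mobility hε0 hx.2)
        (hTf φ hφ.1)
      rw [ENNReal.ofReal_mul (hχ0 t), show 7 * Cχ * C * κ = Cχ * (7 * C * κ) by ring,
        ENNReal.ofReal_mul hCχ0, mul_assoc]
      exact mul_le_mul' (ENNReal.ofReal_le_ofReal (hCχ t)) this
    refine (lintegral_mono_ae hpt).trans ?_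
    -- Additivity of the lower integral needs measurability of only one summand, so none is needed
    -- for the dissipation `D`, which is kept last.
    have hmeas : Measurable fun t =>
        (∫⁻ x in Ioo a b, ENNReal.ofReal (S.u t x * S.uxx t x ^ 2)) +
          ∫⁻ x in Ioo a b, ENNReal.ofReal (1 / 2 * S.ux t x ^ 2) :=
      S.measurable_entropyDensity.add S.measurable_energy
    rw [lintegral_const_mul' _ _ ENNReal.ofReal_ne_top, lintegral_add_left hmeas,
      lintegral_add_left S.measurable_entropyDensity]
    gcongr
    refine hEtot.trans (ENNReal.ofReal_le_ofReal ?_)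
    rw [← hM]
    have : 0 < b - a := by linarith
    gcongr
    exact div_le_self hB1 hL1
  · refine (ofReal_integral_le_lintegral_ofReal_self _).trans ?_
    have hpt : ∀ᵐ t ∂volume.restrict (Ioo 0 T),
        ENNReal.ofReal (χ t * ∫ x in Ioo a b, S.R t x * deriv φ x) ≤
          ENNReal.ofReal (7 * Cχ * C * κ) * (ENNReal.ofReal (K * (b - a)) + D t) := by
      filter_upwards [S.ae_isProfile T, S.ae_u_le hab he hE T] with t hprof hu
      -- From `R² ≤ κ⁶ K d ≤ κ² K d` a Young inequality gives `|R| ≤ κ (K + d)`. The constant is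
      -- then enlarged to `7` to match the source term.
      have hR : ENNReal.ofReal (∫ x in Ioo a b, S.R t x * deriv φ x) ≤
          ENNReal.ofReal (7 * C * κ) * (ENNReal.ofReal (K * (b - a)) + D t) := by
        rw [hprof.integral_posSet fun x _ hx _ => by rw [WeakSolution.R, hx]; ring]
        refine (ofReal_integral_le_lintegral_ofReal (g := fun x => 7 * C * κ *
          (K + |Real.log ε| * mobility n ε (S.u t x) * S.uxxx t x ^ 2)) ?_).trans ?_
        · filter_upwards [ae_restrict_mem hprof.measurableSet_posSet] with x hx
          have hmob : 0 ≤ mobility n ε (S.u t x) :=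
            (pow_nonneg hx.2.le 3).trans (pow_three_le_mobility hε0 hx.2)
          have hflux := flux_sq_le hn0 hn3 hε0 hε1 hx.2 ((hu x hx.1).trans_eq hM.symm) (S.uxxx t x)
          rw [← hK] at hflux
          set d := |Real.log ε| * mobility n ε (S.u t x) * S.uxxx t x ^ 2
          have hd : 0 ≤ d := by positivity
          set r := |Real.log ε| * deriv (Beps n ε) (S.u t x) *
            (ε ^ (3 - n) * S.u t x ^ (n - 1) + S.u t x ^ 2) * S.u t x * S.uxxx t x
          have hr : |S.R t x| ≤ κ * (K + d) := by
            rw [show S.R t x = -r from rfl, abs_neg]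
            refine abs_le_of_sq_le_sq ?_ (by positivity)
            have h1 : r ^ 2 ≤ κ ^ 6 * (K * d) := by
              calc r ^ 2 = κ ^ 6 * (r ^ 2 * |Real.log ε|) := by linear_combination (-r ^ 2) * hl
                _ ≤ _ := by gcongr
            have h2 : κ ^ 6 * (K * d) ≤ κ ^ 2 * (K * d) :=
              mul_le_mul_of_nonneg_right (pow_le_pow_of_le_one hκ.le hκ1 (by norm_num))
                (by positivity)
            nlinarith [mul_nonneg (sq_nonneg κ) (mul_nonneg hK0 hd),
              mul_nonneg (sq_nonneg κ) (sq_nonneg K), mul_nonneg (sq_nonneg κ) (sq_nonneg d)]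
          rw [abs_mul]
          calc |S.R t x| * |deriv φ x| ≤ (κ * (K + d)) * C :=
                mul_le_mul hr (hC1 x) (abs_nonneg _) (by positivity)
            _ ≤ 7 * C * κ * (K + d) := by
              have : 0 ≤ κ * (K + d) * C := by positivity
              linarith
        · calc ∫⁻ x in posSet a b (S.u t), ENNReal.ofReal (7 * C * κ *
                (K + |Real.log ε| * mobility n ε (S.u t x) * S.uxxx t x ^ 2))
              ≤ ∫⁻ x in posSet a b (S.u t), ENNReal.ofReal (7 * C * κ) * (ENNReal.ofReal K +
                ENNReal.ofReal (|Real.log ε| * mobility n ε (S.u t x) * S.uxxx t x ^ 2)) := by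
                refine lintegral_mono fun x => ?_
                rw [ENNReal.ofReal_mul (by positivity)]
                gcongr
                exact ENNReal.ofReal_add_le
            _ = ENNReal.ofReal (7 * C * κ) *
                (ENNReal.ofReal K * volume (posSet a b (S.u t)) + D t) := by
                rw [lintegral_const_mul' _ _ ENNReal.ofReal_ne_top,
                  lintegral_add_left measurable_const, setLIntegral_const]
            _ ≤ _ := by
                gcongr
                rw [ENNReal.ofReal_mul hK0, ← Real.volume_Ioo]
                gcongr
                exact fun x hx => hx.1
      rw [ENNReal.ofReal_mul (hχ0 t), show 7 * Cχ * C * κ = Cχ * (7 * C * κ) by ring,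
        ENNReal.ofReal_mul hCχ0, mul_assoc]
      exact mul_le_mul' (ENNReal.ofReal_le_ofReal (hCχ t)) hR
    refine (lintegral_mono_ae hpt).trans ?_
    rw [lintegral_const_mul' _ _ ENNReal.ofReal_ne_top, lintegral_add_left measurable_const,
      setLIntegral_const, Real.volume_Ioo, sub_zero]
    gcongr

end Solution

end Monotonicity

/-! ### Passage to the limit in the pairings -/

section Limit

open Set

/-- Hölder's inequality is replaced by the pointwise bound `x ≤ η + η^(1-p) x^p`, since nothing is
assumed about the measurability of `N k`. Small `η` handles the first term and convergence the
second. -/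
lemma tendsto_lintegral_of_tendsto_lintegral_rpow {α : Type*} [MeasurableSpace α] {μ : Measure α}
    [IsFiniteMeasure μ] {N : ℕ → α → ℝ≥0∞} {p : ℝ} (hp : 1 ≤ p)
    (h : Tendsto (fun k => ∫⁻ x, N k x ^ p ∂μ) atTop (𝓝 0)) :
    Tendsto (fun k => ∫⁻ x, N k x ∂μ) atTop (𝓝 0) := by
  have hp0 : 0 ≤ p := by linarith
  have hle : ∀ η : ℝ≥0∞, η ≠ 0 → η ≠ ⊤ → ∀ x : ℝ≥0∞, x ≤ η + η / η ^ p * x ^ p := by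
    intro η h0 ht x
    rcases le_total x η with hx | hx
    · exact hx.trans le_self_add
    · refine le_trans ?_ le_add_self
      have h1 : 1 ≤ x / η := by rwa [ENNReal.le_div_iff_mul_le (Or.inl h0) (Or.inl ht), one_mul]
      calc x = η * (x / η) := (ENNReal.mul_div_cancel h0 ht).symm
        _ ≤ η * (x / η) ^ p := by gcongr; exact ENNReal.le_rpow_self_of_one_le h1 hp
        _ = η / η ^ p * x ^ p := by
          rw [ENNReal.div_rpow_of_nonneg _ _ hp0, div_eq_mul_inv, div_eq_mul_inv]; ring
  rw [ENNReal.tendsto_nhds_zero]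
  intro δ hδ
  obtain ⟨η, hη0, hηt, hη⟩ : ∃ η : ℝ≥0∞, η ≠ 0 ∧ η ≠ ⊤ ∧ η * μ univ < δ := by
    rcases eq_or_ne (μ univ) 0 with hμ | hμ
    · exact ⟨1, one_ne_zero, ENNReal.one_ne_top, by simpa [hμ] using hδ⟩
    · have hpos : 0 < δ / μ univ := ENNReal.div_pos hδ.ne' (measure_ne_top _ _)
      obtain ⟨η, hη0, hη⟩ := exists_between hpos
      exact ⟨η, hη0.ne', (hη.trans_le le_top).ne,
        (ENNReal.lt_div_iff_mul_lt (Or.inl hμ) (Or.inl (measure_ne_top _ _))).1 hη⟩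
  have hc : η / η ^ p ≠ ⊤ := ENNReal.div_ne_top hηt
    (ENNReal.rpow_pos (pos_iff_ne_zero.2 hη0) hηt).ne'
  have hlim : Tendsto (fun k => η * μ univ + η / η ^ p * ∫⁻ x, N k x ^ p ∂μ) atTop
      (𝓝 (η * μ univ + η / η ^ p * 0)) :=
    tendsto_const_nhds.add (ENNReal.Tendsto.const_mul h (Or.inr hc))
  rw [mul_zero, add_zero] at hlim
  filter_upwards [(tendsto_order.1 hlim).2 δ hη] with k hk
  refine le_trans ?_ hk.le
  calc ∫⁻ x, N k x ∂μ ≤ ∫⁻ x, (η + η / η ^ p * N k x ^ p) ∂μ :=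
        lintegral_mono fun x => hle η hη0 hηt _
    _ = _ := by
      rw [lintegral_add_left measurable_const, lintegral_const, lintegral_const_mul' _ _ hc]

/-- Every admissible decomposition `g₀ + ∂ₓ g₁` gives the bound with its own cost. Strict positivity
of `C` allows dividing by it before taking the infimum, also when the norm is infinite. -/
lemma enorm_integral_mul_le_negSobolevNorm {a b C : ℝ} {f φ : ℝ → ℝ}
    (hφ : IsTestFunction (Ioo a b) φ) (hC : 0 < C) (hC0 : ∀ x, |φ x| ≤ C)
    (hC1 : ∀ x, |deriv φ x| ≤ C) :
    ‖∫ x in Ioo a b, f x * φ x‖ₑ ≤ ENNReal.ofReal C * negSobolevNorm a b f := by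
  have hC' : ENNReal.ofReal C ≠ 0 := by simpa using hC
  rw [mul_comm, ← ENNReal.div_le_iff hC' ENNReal.ofReal_ne_top]
  refine le_iInf fun g₀ => le_iInf fun g₁ => le_iInf fun hg => ?_
  rw [ENNReal.div_le_iff hC' ENNReal.ofReal_ne_top, hg.2.2.2 φ hφ]
  have hbd : ∀ {g k : ℝ → ℝ}, (∀ x, |k x| ≤ C) → ‖∫ x in Ioo a b, g x * k x‖ₑ ≤
      (∫⁻ x in Ioo a b, ‖g x‖ₑ) * ENNReal.ofReal C := fun {g k} hk => by
    refine (enorm_integral_le_lintegral_enorm _).trans ?_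
    rw [← lintegral_mul_const' _ _ ENNReal.ofReal_ne_top]
    refine lintegral_mono fun x => ?_
    rw [enorm_mul]
    gcongr
    rw [← ofReal_norm]
    exact ENNReal.ofReal_le_ofReal (hk x)
  rw [add_mul]
  exact (enorm_sub_le).trans (add_le_add (hbd hC0) (hbd hC1))

lemma integrable_pairing {a b T : ℝ} {f : ℝ → ℝ → ℝ} {φ : ℝ → ℝ}
    (hf : IntegrableOn (Function.uncurry f) (Ioo 0 T ×ˢ Ioo a b))
    (hφ : IsTestFunction (Ioo a b) φ) :
    IntegrableOn (fun t => ∫ x in Ioo a b, f t x * φ x) (Ioo 0 T) := by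
  obtain ⟨C, -, hC⟩ := hφ.exists_bound
  rw [IntegrableOn, Measure.volume_eq_prod, ← Measure.prod_restrict] at hf
  have h := hf.mul_bdd (g := fun z : ℝ × ℝ => φ z.2) (c := C)
    (hφ.continuous.comp continuous_snd).aestronglyMeasurable (Eventually.of_forall fun z => hC z.2)
  exact h.integral_prod_left

lemma ae_integrable_slice {a b T : ℝ} {f : ℝ → ℝ → ℝ}
    (hf : IntegrableOn (Function.uncurry f) (Ioo 0 T ×ˢ Ioo a b)) :
    ∀ᵐ t ∂volume.restrict (Ioo 0 T), IntegrableOn (f t) (Ioo a b) := by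
  rw [IntegrableOn, Measure.volume_eq_prod, ← Measure.prod_restrict] at hf
  exact hf.prod_right_ae

lemma Solution.integrableOn_rho {n a b : ℝ} {uin uin' : ℝ → ℝ} {ε : ℝ}
    (S : Solution n a b uin uin' ε) (hn0 : 0 < n) (hn3 : n < 3) (hε0 : 0 < ε) (hε1 : ε < 1)
    (hab : a < b) {e : ℝ} (he : 0 ≤ e)
    (hE : ∫⁻ x in Ioo a b, ENNReal.ofReal (1 / 2 * uin' x ^ 2) ≤ ENNReal.ofReal e) (T : ℝ) :
    IntegrableOn (Function.uncurry S.rho) (Ioo 0 T ×ˢ Ioo a b) := by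
  -- Measurability is obtained through `max u 0`, because `B` is controlled only on `[0,∞)`; nothing
  -- changes where `u ≥ 0`.
  set r : ℝ × ℝ → ℝ := fun z => Beps n ε (max (S.u z.1 z.2) 0) with hr
  have hrm : Measurable r := (measurable_Beps_max hn0 hn3 hε0).comp S.measurable_u
  have heq : EqOn r (Function.uncurry S.rho) (Ioo 0 T ×ˢ Ioo a b) := fun z hz => by
    simp only [hr, Function.uncurry, WeakSolution.rho]
    rw [max_eq_left (S.nonneg _ hz.1.1 _ (Ioo_subset_Icc_self hz.2))]
  refine IntegrableOn.congr_fun (f := r) ?_ heq (measurableSet_Ioo.prod measurableSet_Ioo)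
  set ρmax := 1 + (B n 1 + Real.log (heightBound a b (∫ x in Ioo a b, uin x) e)) / |Real.log ε|
  have hbd : ∀ᵐ z ∂volume.restrict (Ioo 0 T ×ˢ Ioo a b), ‖r z‖ ≤ ρmax := by
    rw [Measure.volume_eq_prod, ← Measure.prod_restrict,
      Measure.ae_prod_iff_ae_ae (measurableSet_le hrm.norm measurable_const)]
    filter_upwards [S.ae_rho_mem hn0 hn3 hε0 hε1 hab he hE T, ae_restrict_mem measurableSet_Ioo]
      with t ht htI
    filter_upwards [ae_restrict_mem measurableSet_Ioo] with x hx
    rw [heq (show (t, x) ∈ Ioo 0 T ×ˢ Ioo a b from ⟨htI, hx⟩)]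
    exact (Real.norm_of_nonneg (ht x hx).1).trans_le (ht x hx).2
  have hfin : volume (Ioo 0 T ×ˢ Ioo a b) < ⊤ := by
    rw [Measure.volume_eq_prod, Measure.prod_prod]
    simp only [Real.volume_Ioo]
    exact ENNReal.mul_lt_top ENNReal.ofReal_lt_top ENNReal.ofReal_lt_top
  have : IsFiniteMeasure (volume.restrict (Ioo 0 T ×ˢ Ioo a b)) := ⟨by simpa using hfin⟩
  exact Integrable.of_bound hrm.aestronglyMeasurable ρmax hbd

/-- The limit of `ρ^ε`, tested with a non-negative function, is non-decreasing in time and bounded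
by the integral of the test function. -/
lemma exists_null_pairing_mono {n : ℝ} (hn0 : 0 < n) (hn3 : n < 3) {a b : ℝ} (hab : a < b)
    {uin uin' : ℝ → ℝ} (huin_L2 : MemLp uin' 2 (volume.restrict (Ioo a b)))
    (S : (ε : Ioo (0 : ℝ) 1) → Solution n a b uin uin' (ε : ℝ)) {p : ℝ} (hp : 1 ≤ p)
    {ρ : ℝ → ℝ → ℝ} {ε : ℕ → Ioo (0 : ℝ) 1} (hε : Tendsto (fun k => (ε k : ℝ)) atTop (𝓝 0))
    {T : ℝ} (hT : 0 < T) (hρ : IntegrableOn (Function.uncurry ρ) (Ioo 0 T ×ˢ Ioo a b))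
    (hlim : Tendsto (fun k => ∫⁻ t in Ioo 0 T,
      (negSobolevNorm a b (fun x => (S (ε k)).rho t x - ρ t x)) ^ p) atTop (𝓝 0))
    {φ : ℝ → ℝ} (hφ : IsTestFunction (Ioo a b) φ) (hφ0 : ∀ x, 0 ≤ φ x) :
    ∃ N : Set ℝ, volume N = 0 ∧
      (∀ t, t ∉ N → 0 < t → t < T → ∫ x in Ioo a b, ρ t x * φ x ≤ ∫ x in Ioo a b, φ x) ∧
      ∀ s t, s ∉ N → t ∉ N → 0 < s → s < t → t < T →
        ∫ x in Ioo a b, ρ s x * φ x ≤ ∫ x in Ioo a b, ρ t x * φ x := by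
  -- constants
  set e := (∫⁻ x in Ioo a b, ENNReal.ofReal (1 / 2 * uin' x ^ 2)).toReal with he_def
  have he : 0 ≤ e := ENNReal.toReal_nonneg
  have hE : ∫⁻ x in Ioo a b, ENNReal.ofReal (1 / 2 * uin' x ^ 2) ≤ ENNReal.ofReal e := by
    rw [he_def, ENNReal.ofReal_toReal]
    have h1 : Integrable (fun x => 1 / 2 * uin' x ^ 2) (volume.restrict (Ioo a b)) :=
      huin_L2.integrable_sq.const_mul _
    exact (lintegral_ofReal_ne_top_iff_integrable h1.aestronglyMeasurable
      (Eventually.of_forall fun x => by positivity)).2 h1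
  obtain ⟨C₀, hC₀, hφC₀⟩ := hφ.exists_bound
  obtain ⟨C₁, hC₁, hφC₁⟩ := hφ.deriv.exists_bound
  obtain ⟨C₂, hC₂, hφC₂⟩ := hφ.deriv.deriv.exists_bound
  set C := 1 + C₀ + C₁ + C₂ with hCdef
  have hC : 0 < C := by positivity
  have hC0 : ∀ x, |φ x| ≤ C := fun x => (hφC₀ x).trans (by linarith)
  have hC1 : ∀ x, |deriv φ x| ≤ C := fun x => (hφC₁ x).trans (by linarith)
  have hC2 : ∀ x, |deriv (deriv φ) x| ≤ C := fun x => (hφC₂ x).trans (by linarith)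
  set M := heightBound a b (∫ x in Ioo a b, uin x) e with hM
  set L : ℕ → ℝ := fun k => |Real.log (ε k : ℝ)| with hLdef
  have hLtop : Tendsto L atTop atTop := by
    refine tendsto_abs_atBot_atTop.comp (Real.tendsto_log_nhdsGT_zero.comp ?_)
    exact tendsto_nhdsWithin_iff.2 ⟨hε, Eventually.of_forall fun k => (ε k).2.1⟩
  -- convergence of the pairings
  set g : ℝ → ℝ := fun t => ∫ x in Ioo a b, ρ t x * φ x with hg
  set G : ℕ → ℝ → ℝ := fun k t => ∫ x in Ioo a b, (S (ε k)).rho t x * φ x with hG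
  have hρk : ∀ k, IntegrableOn (Function.uncurry (S (ε k)).rho) (Ioo 0 T ×ˢ Ioo a b) := fun k =>
    (S (ε k)).integrableOn_rho hn0 hn3 (ε k).2.1 (ε k).2.2 hab he hE T
  have hgi : IntegrableOn g (Ioo 0 T) := integrable_pairing hρ hφ
  have hGi : ∀ k, IntegrableOn (G k) (Ioo 0 T) := fun k => integrable_pairing (hρk k) hφ
  have hGg : Tendsto (fun k => ∫⁻ t in Ioo 0 T, ‖G k t - g t‖ₑ) atTop (𝓝 0) := by
    have h1 := ENNReal.Tendsto.const_mul (a := ENNReal.ofReal C)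
      (tendsto_lintegral_of_tendsto_lintegral_rpow hp hlim) (Or.inr ENNReal.ofReal_ne_top)
    rw [mul_zero] at h1
    refine tendsto_of_tendsto_of_tendsto_of_le_of_le tendsto_const_nhds h1 (fun _ => zero_le)
      fun k => ?_
    simp only
    rw [← lintegral_const_mul' _ _ ENNReal.ofReal_ne_top]
    refine lintegral_mono_ae ?_
    filter_upwards [ae_integrable_slice hρ, ae_integrable_slice (hρk k)] with t h2 h3
    have hbdd : ∀ {f : ℝ → ℝ}, IntegrableOn f (Ioo a b) →
        IntegrableOn (fun x => f x * φ x) (Ioo a b) := fun hf =>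
      hf.mul_bdd hφ.continuous.aestronglyMeasurable (Eventually.of_forall hC0)
    have h4 : G k t - g t = ∫ x in Ioo a b, ((S (ε k)).rho t x - ρ t x) * φ x := by
      simp only [hG, hg]
      rw [← integral_sub (hbdd h3) (hbdd h2)]
      congr 1; ext x; ring
    rw [h4]
    exact enorm_integral_mul_le_negSobolevNorm hφ hC hC0 hC1
  -- the upper bound
  have hupper : ∀ᵐ t ∂volume.restrict (Ioo 0 T), g t ≤ ∫ x in Ioo a b, φ x := by
    set c := ∫ x in Ioo a b, φ x with hc
    set Bd := B n 1 + Real.log M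
    -- Bound `g - c` by `|G_k - g| + (G_k - c)` and use `G_k ≤ (1 + Bd/L_k) c`; both contributions
    -- vanish in the limit.
    have hkey : ∀ k, ∫⁻ t in Ioo 0 T, ENNReal.ofReal (g t - c) ≤
        (∫⁻ t in Ioo 0 T, ‖G k t - g t‖ₑ) + ENNReal.ofReal (Bd / L k * c) * ENNReal.ofReal T := by
      intro k
      have hm : ∫⁻ _ in Ioo 0 T, ENNReal.ofReal (Bd / L k * c) =
          ENNReal.ofReal (Bd / L k * c) * ENNReal.ofReal T := by
        rw [setLIntegral_const, Real.volume_Ioo, sub_zero]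
      rw [← hm, ← lintegral_add_right _ measurable_const]
      refine lintegral_mono_ae ?_
      filter_upwards [(S (ε k)).ae_rho_mem hn0 hn3 (ε k).2.1 (ε k).2.2 hab he hE T,
        ae_integrable_slice (hρk k)] with t h1 h2
      have h3 : G k t ≤ (1 + Bd / L k) * c := by
        simp only [hG, hc]
        rw [← integral_const_mul]
        refine setIntegral_mono_on
          (h2.mul_bdd hφ.continuous.aestronglyMeasurable (Eventually.of_forall hC0))
          ((hφ.continuous.integrable_of_hasCompactSupport hφ.2.1).integrableOn.const_mul _)
          measurableSet_Ioo fun x hx => mul_le_mul_of_nonneg_right (h1 x hx).2 (hφ0 x)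
      rw [← ofReal_norm]
      refine (ENNReal.ofReal_le_ofReal ?_).trans ENNReal.ofReal_add_le
      rw [Real.norm_eq_abs]
      linarith [neg_abs_le (G k t - g t)]
    have hlim0 : Tendsto (fun k => (∫⁻ t in Ioo 0 T, ‖G k t - g t‖ₑ) +
        ENNReal.ofReal (Bd / L k * c) * ENNReal.ofReal T) atTop (𝓝 0) := by
      have h1 : Tendsto (fun k => Bd / L k * c) atTop (𝓝 0) := by
        simpa using (tendsto_const_nhds.div_atTop hLtop).mul_const c
      have h2 := ENNReal.Tendsto.mul_const (b := ENNReal.ofReal T) (ENNReal.tendsto_ofReal h1)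
        (Or.inr ENNReal.ofReal_ne_top)
      rw [ENNReal.ofReal_zero, zero_mul] at h2
      simpa using hGg.add h2
    have hzero : ∫⁻ t in Ioo 0 T, ENNReal.ofReal (g t - c) = 0 :=
      le_antisymm (ge_of_tendsto' hlim0 hkey) zero_le
    rw [lintegral_eq_zero_iff' (hgi.aestronglyMeasurable.aemeasurable.sub_const c).ennreal_ofReal]
      at hzero
    filter_upwards [hzero] with t ht
    have := ENNReal.ofReal_eq_zero.1 ht
    linarith
  -- monotonicity in the sense of distributions
  have hdist : ∀ χ : ℝ → ℝ, IsTestFunction (Ioo 0 T) χ → (∀ t, 0 ≤ χ t) → (∀ t, χ t ≤ 1) →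
      ∫ t in Ioo 0 T, g t * deriv χ t ≤ 0 := by
    intro χ hχ hχ0 hχ1
    obtain ⟨D, hD, hχD⟩ := hχ.deriv.exists_bound
    have hconv : Tendsto (fun k => ∫ t in Ioo 0 T, deriv χ t * G k t) atTop
        (𝓝 (∫ t in Ioo 0 T, deriv χ t * g t)) := by
      have hmul : ∀ {f : ℝ → ℝ}, IntegrableOn f (Ioo 0 T) →
          IntegrableOn (fun t => deriv χ t * f t) (Ioo 0 T) := fun hf =>
        hf.bdd_mul hχ.deriv.continuous.aestronglyMeasurable (Eventually.of_forall hχD)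
      refine tendsto_integral_of_L1 _ (hmul hgi).aestronglyMeasurable
        (Eventually.of_forall fun k => hmul (hGi k)) ?_
      have h1 := ENNReal.Tendsto.const_mul (a := ENNReal.ofReal D) hGg
        (Or.inr ENNReal.ofReal_ne_top)
      rw [mul_zero] at h1
      refine tendsto_of_tendsto_of_tendsto_of_le_of_le tendsto_const_nhds h1 (fun _ => zero_le)
        fun k => ?_
      simp only
      rw [← lintegral_const_mul' _ _ ENNReal.ofReal_ne_top]
      refine lintegral_mono fun t => ?_
      rw [← mul_sub, enorm_mul, ← ofReal_norm (deriv χ t)]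
      gcongr
      exact hχD t
    set A : ℝ≥0∞ := (ENNReal.ofReal ((b - a) * (1 + (B n 1 + Real.log M))) +
        ENNReal.ofReal e * ENNReal.ofReal T + ENNReal.ofReal e) +
        (ENNReal.ofReal ((8 + 36 / n ^ 2) * (1 + M) * (b - a)) * ENNReal.ofReal T +
          ENNReal.ofReal e) with hA
    have hAt : A ≠ ⊤ := by
      simp [hA, ENNReal.mul_ne_top]
    -- The choice `κ = |ln ε|^(-1/6)` is forced by `κ⁶ |ln ε| = 1`.
    have hκ : Tendsto (fun k => L k ^ (-(1 / 6) : ℝ)) atTop (𝓝 0) :=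
      (tendsto_rpow_neg_atTop (by norm_num)).comp hLtop
    have hbound : ∀ᶠ k in atTop, ENNReal.ofReal (∫ t in Ioo 0 T, deriv χ t * G k t) ≤
        ENNReal.ofReal (7 * 1 * C * L k ^ (-(1 / 6) : ℝ)) * A := by
      filter_upwards [hLtop.eventually_ge_atTop 1] with k hk
      have hLk : 0 < L k := by linarith
      refine (S (ε k)).ofReal_integral_deriv_mul_rho_le hn0 hn3 (ε k).2.1 (ε k).2.2 hab he hE hT
        hχ hχ0 hφ hφ0 hχ1 hC0 hC1 hC2 (Real.rpow_pos_of_pos hLk _)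
        (Real.rpow_le_one_of_one_le_of_nonpos hk (by norm_num)) ?_ hM
      rw [← Real.rpow_natCast, ← Real.rpow_mul hLk.le]
      norm_num
      rw [Real.rpow_neg_one]
      exact inv_mul_cancel₀ hLk.ne'
    have hrhs : Tendsto (fun k => ENNReal.ofReal (7 * 1 * C * L k ^ (-(1 / 6) : ℝ)) * A) atTop
        (𝓝 0) := by
      have h1 : Tendsto (fun k => 7 * 1 * C * L k ^ (-(1 / 6) : ℝ)) atTop (𝓝 0) := by
        simpa using hκ.const_mul (7 * 1 * C)
      have h2 := ENNReal.Tendsto.mul_const (b := A) (ENNReal.tendsto_ofReal h1) (Or.inr hAt)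
      rwa [ENNReal.ofReal_zero, zero_mul] at h2
    have hle := le_of_tendsto_of_tendsto (ENNReal.tendsto_ofReal hconv) hrhs hbound
    have := ENNReal.ofReal_eq_zero.1 (le_antisymm hle zero_le)
    simpa only [mul_comm] using this
  -- Choosing `χ` to approximate the indicator of `(s,t)`, the inequality `∫ g χ' ≤ 0` becomes `g s
  -- - g t ≤ 0` off the exceptional set of `g`.
  obtain ⟨N, hN, H⟩ := exists_null_forall_testFunction hgi
  rw [ae_restrict_iff' measurableSet_Ioo, ae_iff] at hupper
  refine ⟨N ∪ _, measure_union_null hN hupper, fun t ht h0 hT' => ?_,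
    fun s t hs ht h0 hst htT => ?_⟩
  · by_contra hcon
    exact ht (Or.inr fun h => hcon (h ⟨h0, hT'⟩))
  · obtain ⟨χ, hχ, hχ0, hχ1, -, hχlim⟩ := H s t (fun h => hs (Or.inl h)) (fun h => ht (Or.inl h))
      h0 hst htT
    have := le_of_tendsto' hχlim fun j => hdist (χ j) (hχ j) (hχ0 j) (hχ1 j)
    linarith

end Limit

/-! ### From countably many test functions to all intervals -/

section Intervals

open Set

/-- Smooth functions that approximate the indicator of `(c,d)` from below. -/
noncomputable def smoothIndicator (c d : ℝ) (j : ℕ) (x : ℝ) : ℝ :=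
  Real.smoothTransition (j * (x - c)) * Real.smoothTransition (j * (d - x))

lemma smoothIndicator_nonneg (c d : ℝ) (j : ℕ) (x : ℝ) : 0 ≤ smoothIndicator c d j x :=
  mul_nonneg (Real.smoothTransition.nonneg _) (Real.smoothTransition.nonneg _)

lemma smoothIndicator_le_one (c d : ℝ) (j : ℕ) (x : ℝ) : smoothIndicator c d j x ≤ 1 :=
  mul_le_one₀ (Real.smoothTransition.le_one _) (Real.smoothTransition.nonneg _)
    (Real.smoothTransition.le_one _)

lemma smoothIndicator_eq_zero {c d : ℝ} (j : ℕ) {x : ℝ} (hx : x ∉ Ioo c d) :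
    smoothIndicator c d j x = 0 := by
  rw [mem_Ioo, not_and_or, not_lt, not_lt] at hx
  rcases hx with hx | hx
  · rw [smoothIndicator, Real.smoothTransition.zero_of_nonpos
      (mul_nonpos_of_nonneg_of_nonpos (Nat.cast_nonneg j) (by linarith)), zero_mul]
  · rw [smoothIndicator, Real.smoothTransition.zero_of_nonpos (x := j * (d - x))
      (mul_nonpos_of_nonneg_of_nonpos (Nat.cast_nonneg j) (by linarith)), mul_zero]

lemma isTestFunction_smoothIndicator {a b c d : ℝ} (hac : a < c) (hdb : d < b) (j : ℕ) :
    IsTestFunction (Ioo a b) (smoothIndicator c d j) := by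
  have h0 : ∀ x, x ∉ Icc c d → smoothIndicator c d j x = 0 := fun x hx =>
    smoothIndicator_eq_zero j fun h => hx (Ioo_subset_Icc_self h)
  refine ⟨?_, HasCompactSupport.intro isCompact_Icc h0, ?_⟩
  · exact (Real.smoothTransition.contDiff.comp
      (contDiff_const.mul (contDiff_id.sub contDiff_const))).mul
      (Real.smoothTransition.contDiff.comp (contDiff_const.mul (contDiff_const.sub contDiff_id)))
  · exact (closure_minimal (fun x hx => by_contra fun h => (Function.mem_support.1 hx) (h0 x h))
      isClosed_Icc).trans (Icc_subset_Ioo hac hdb)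

lemma tendsto_smoothIndicator (c d x : ℝ) :
    Tendsto (fun j => smoothIndicator c d j x) atTop (𝓝 ((Ioo c d).indicator 1 x)) := by
  by_cases hx : x ∈ Ioo c d
  · rw [indicator_of_mem hx, Pi.one_apply]
    have hone : ∀ r : ℝ, 0 < r → ∀ᶠ j : ℕ in atTop, Real.smoothTransition (j * r) = 1 := by
      intro r hr
      filter_upwards [(tendsto_natCast_atTop_atTop.atTop_mul_const hr).eventually_ge_atTop 1]
        with j hj using Real.smoothTransition.one_of_one_le hj
    refine tendsto_const_nhds.congr' ?_
    filter_upwards [hone _ (sub_pos.2 hx.1), hone _ (sub_pos.2 hx.2)] with j h1 h2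
    rw [smoothIndicator, h1, h2, one_mul]
  · rw [indicator_of_notMem hx]
    exact tendsto_const_nhds.congr fun j => (smoothIndicator_eq_zero j hx).symm

/-- Dominated convergence is used twice: from smooth indicators to rational intervals, then from
rational intervals to an arbitrary one. -/
lemma setIntegral_nonneg_of_smoothIndicator {a b : ℝ} {w : ℝ → ℝ} (hw : IntegrableOn w (Ioo a b))
    (h : ∀ c d : ℚ, a < c → (d : ℝ) < b → ∀ j,
      0 ≤ ∫ x in Ioo a b, w x * smoothIndicator c d j x)
    {α β : ℝ} (haα : a ≤ α) (hβb : β ≤ b) : 0 ≤ ∫ x in Ioo α β, w x := by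
  have hdom : ∀ {f : ℕ → ℝ → ℝ} {s : Set ℝ}, MeasurableSet s → s ⊆ Ioo a b →
      (∀ j, Measurable (f j)) → (∀ j x, 0 ≤ f j x) → (∀ j x, f j x ≤ 1) →
      (∀ x, Tendsto (fun j => f j x) atTop (𝓝 (s.indicator 1 x))) →
      Tendsto (fun j => ∫ x in Ioo a b, w x * f j x) atTop (𝓝 (∫ x in s, w x)) := by
    intro f s hs hsub hm h0 h1 hl
    rw [← setIntegral_mul_indicator_one measurableSet_Ioo hs hsub]
    refine tendsto_integral_of_dominated_convergence (fun x => ‖w x‖)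
      (fun j => hw.aestronglyMeasurable.mul (hm j).aestronglyMeasurable) hw.norm
      (fun j => Eventually.of_forall fun x => ?_)
      (Eventually.of_forall fun x => (hl x).const_mul _)
    rw [norm_mul, Real.norm_of_nonneg (h0 j x)]
    exact mul_le_of_le_one_right (norm_nonneg _) (h1 j x)
  have hrat : ∀ c d : ℚ, a < c → (d : ℝ) < b → 0 ≤ ∫ x in Ioo (c : ℝ) d, w x :=
    fun c d hc hd => ge_of_tendsto'
      (hdom measurableSet_Ioo (Ioo_subset_Ioo hc.le hd.le)
        (fun j => (isTestFunction_smoothIndicator hc hd j).continuous.measurable)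
        (smoothIndicator_nonneg _ _) (smoothIndicator_le_one _ _)
        (tendsto_smoothIndicator _ _)) (h c d hc hd)
  -- Exhausting from inside with strict inequalities permits `α = a` or `β = b`, although the test
  -- functions must have compact support in `(a,b)`. Balls that reach the boundary need this.
  obtain ⟨c, -, hcα, hc⟩ := Real.exists_seq_rat_strictAnti_tendsto α
  obtain ⟨d, -, hdβ, hd⟩ := Real.exists_seq_rat_strictMono_tendsto β
  have hsub : ∀ j, Ioo (c j : ℝ) (d j) ⊆ Ioo a b := fun j =>
    Ioo_subset_Ioo (haα.trans (hcα j).le) ((hdβ j).le.trans hβb)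
  refine ge_of_tendsto' (hdom (f := fun j => (Ioo (c j : ℝ) (d j)).indicator 1) measurableSet_Ioo
    (Ioo_subset_Ioo haα hβb) (fun j => measurable_one.indicator measurableSet_Ioo)
    (fun j x => indicator_nonneg (fun _ _ => zero_le_one) x)
    (fun j x => indicator_le_self' (fun _ _ => zero_le_one) x) fun x => ?_) fun j => ?_
  · by_cases hx : x ∈ Ioo α β
    · rw [indicator_of_mem hx]
      refine tendsto_const_nhds.congr' ?_
      filter_upwards [(tendsto_order.1 hc).2 x hx.1, (tendsto_order.1 hd).1 x hx.2] with j h1 h2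
      rw [indicator_of_mem (show x ∈ Ioo (c j : ℝ) (d j) from ⟨h1, h2⟩)]
    · rw [indicator_of_notMem hx]
      refine tendsto_const_nhds.congr fun j => ?_
      rw [indicator_of_notMem fun h => hx ⟨(hcα j).trans h.1, h.2.trans (hdβ j)⟩]
  · rw [setIntegral_mul_indicator_one measurableSet_Ioo measurableSet_Ioo (hsub j)]
    exact hrat _ _ (haα.trans_lt (hcα j)) ((hdβ j).trans_le hβb)

/-- If `ρ(s,·) ≤ ρ(t,·) ≤ 1` in the sense of distributions, then the apparent support at time `s`
is contained in the one at time `t`. -/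
lemma apparentSupport_subset {a b : ℝ} {ρ : ℝ → ℝ → ℝ} {s t : ℝ}
    (hs : IntegrableOn (ρ s) (Ioo a b)) (ht : IntegrableOn (ρ t) (Ioo a b))
    (hmono : ∀ c d : ℚ, a < c → (d : ℝ) < b → ∀ j,
      ∫ x in Ioo a b, ρ s x * smoothIndicator c d j x ≤
        ∫ x in Ioo a b, ρ t x * smoothIndicator c d j x)
    (hle : ∀ c d : ℚ, a < c → (d : ℝ) < b → ∀ j,
      ∫ x in Ioo a b, ρ t x * smoothIndicator c d j x ≤
        ∫ x in Ioo a b, smoothIndicator c d j x) :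
    apparentSupport a b ρ s ⊆ apparentSupport a b ρ t := by
  rintro x ⟨hx, r, hr, hzero⟩
  refine ⟨hx, r, hr, ?_⟩
  rw [Real.ball_eq_Ioo, Ioo_inter_Ioo] at hzero ⊢
  have hone : IntegrableOn (fun _ : ℝ => (1 : ℝ)) (Ioo a b) := by simp
  have hmul : ∀ {f : ℝ → ℝ} {c d : ℚ} (j : ℕ), a < c → (d : ℝ) < b → IntegrableOn f (Ioo a b) →
      IntegrableOn (fun x => f x * smoothIndicator c d j x) (Ioo a b) := fun {_ c d} j hc hd hf =>
    hf.mul_bdd (c := 1) (isTestFunction_smoothIndicator hc hd j).continuous.aestronglyMeasurable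
      (Eventually.of_forall fun x => by
        rw [Real.norm_of_nonneg (smoothIndicator_nonneg _ _ _ _)]
        exact smoothIndicator_le_one _ _ _ _)
  have h1 : 0 ≤ ∫ y in Ioo (max (x - r) a) (min (x + r) b), (1 - ρ t y) := by
    refine setIntegral_nonneg_of_smoothIndicator (hone.sub ht) (fun c d hc hd j => ?_)
      (le_max_right _ _) (min_le_right _ _)
    have := integral_sub (hmul j hc hd hone) (hmul j hc hd ht)
    simp only [one_mul] at this
    simp only [Pi.sub_apply, sub_mul, one_mul]
    rw [this]
    exact sub_nonneg.2 (hle c d hc hd j)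
  have h2 : 0 ≤ ∫ y in Ioo (max (x - r) a) (min (x + r) b), (ρ t y - ρ s y) := by
    refine setIntegral_nonneg_of_smoothIndicator (ht.sub hs) (fun c d hc hd j => ?_)
      (le_max_right _ _) (min_le_right _ _)
    simp only [Pi.sub_apply, sub_mul]
    rw [integral_sub (hmul j hc hd ht) (hmul j hc hd hs)]
    exact sub_nonneg.2 (hmono c d hc hd j)
  have hsub : Ioo (max (x - r) a) (min (x + r) b) ⊆ Ioo a b :=
    Ioo_subset_Ioo (le_max_right _ _) (min_le_right _ _)
  -- The vanishing integral at time `s` is a sum of two non-negative integrals, so the first, the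
  -- one at time `t`, vanishes.
  have h3 : ∫ y in Ioo (max (x - r) a) (min (x + r) b), (1 - ρ s y) =
      (∫ y in Ioo (max (x - r) a) (min (x + r) b), (1 - ρ t y)) +
        ∫ y in Ioo (max (x - r) a) (min (x + r) b), (ρ t y - ρ s y) := by
    have h := integral_add ((hone.sub ht).mono_set hsub) ((ht.sub hs).mono_set hsub)
    simp only [Pi.sub_apply] at h
    rw [← h]
    congr 1; ext y; ring
  have h4 : ∫ y in Ioo (max (x - r) a) (min (x + r) b), (1 - ρ s y) = 0 := hzero
  exact le_antisymm (by linarith) h1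

end Intervals

end ThinFilm

/-! ### Countable unions of null sets -/

theorem corollary1
    (n : ℝ) (hn0 : 0 < n) (hn3 : n < 3)
    (a b : ℝ) (hab : a < b)
    -- the initial datum: a non-negative function in `H¹(a,b)`
    (uin uin' : ℝ → ℝ) (huin_cont : ContinuousOn uin (Set.Icc a b))
    (huin_nonneg : ∀ x ∈ Set.Icc a b, 0 ≤ uin x)
    (huin_deriv : ThinFilm.HasWeakDerivOn (Set.Ioo a b) uin uin')
    (huin_L2 : MemLp uin' 2 (volume.restrict (Set.Ioo a b)))
    -- the solutions `u^ε`
    (S : (ε : Set.Ioo (0 : ℝ) 1) → ThinFilm.Solution n a b uin uin' (ε : ℝ))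
    -- the time horizon, finite or infinite
    (T : EReal) (hT : 0 < T)
    -- `ρ` is the limit of `ρ^{ε_k}` in `L^p(0,T'; W^{-1,1}(a,b))` for all finite `T' ≤ T`
    (p : ℝ) (hp : 1 ≤ p)
    (ρ : ℝ → ℝ → ℝ)
    (hρ : ∀ T' : ℝ, 0 < T' → (T' : EReal) ≤ T →
      IntegrableOn (Function.uncurry ρ) (Set.Ioo 0 T' ×ˢ Set.Ioo a b))
    (ε : ℕ → Set.Ioo (0 : ℝ) 1) (hε : Tendsto (fun k => (ε k : ℝ)) atTop (𝓝 0))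
    (hlim : ∀ T' : ℝ, 0 < T' → (T' : EReal) ≤ T →
      Tendsto (fun k => ∫⁻ t in Set.Ioo 0 T',
        (ThinFilm.negSobolevNorm a b (fun x => (S (ε k)).rho t x - ρ t x)) ^ p)
        atTop (𝓝 0)) :
    -- `ρ(t,·)` is defined for almost every `t`; the inclusion holds for all such `s < t`
    ∃ N : Set ℝ, volume N = 0 ∧
      ∀ s t : ℝ, s ∉ N → t ∉ N → 0 < s → s < t → (t : EReal) < T →
        ThinFilm.apparentSupport a b ρ s ⊆ ThinFilm.apparentSupport a b ρ t := by
  have hloc : ∀ q : ℚ, 0 < (q : ℝ) → ((q : ℝ) : EReal) ≤ T → ∃ N : Set ℝ, volume N = 0 ∧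
      ∀ s t : ℝ, s ∉ N → t ∉ N → 0 < s → s < t → t < q →
        ThinFilm.apparentSupport a b ρ s ⊆ ThinFilm.apparentSupport a b ρ t := by
    intro q hq hqT
    -- The null set depends on the test function; indexing by rational endpoints and a natural
    -- number keeps the union null. Indices whose interval is not compactly inside `(a,b)` receive
    -- the empty set.
    have hpair : ∀ i : ℚ × ℚ × ℕ, ∃ N : Set ℝ, volume N = 0 ∧ (a < i.1 → (i.2.1 : ℝ) < b →
        (∀ t, t ∉ N → 0 < t → t < q →
          ∫ x in Set.Ioo a b, ρ t x * ThinFilm.smoothIndicator i.1 i.2.1 i.2.2 x ≤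
            ∫ x in Set.Ioo a b, ThinFilm.smoothIndicator i.1 i.2.1 i.2.2 x) ∧
        ∀ s t, s ∉ N → t ∉ N → 0 < s → s < t → t < q →
          ∫ x in Set.Ioo a b, ρ s x * ThinFilm.smoothIndicator i.1 i.2.1 i.2.2 x ≤
            ∫ x in Set.Ioo a b, ρ t x * ThinFilm.smoothIndicator i.1 i.2.1 i.2.2 x) := by
      intro i
      by_cases hi : a < i.1 ∧ (i.2.1 : ℝ) < b
      · obtain ⟨N, hN, h1, h2⟩ := ThinFilm.exists_null_pairing_mono hn0 hn3 hab huin_L2 S hp hε hq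
          (hρ q hq hqT) (hlim q hq hqT) (ThinFilm.isTestFunction_smoothIndicator hi.1 hi.2 i.2.2)
          (ThinFilm.smoothIndicator_nonneg _ _ _)
        exact ⟨N, hN, fun _ _ => ⟨h1, h2⟩⟩
      · exact ⟨∅, measure_empty, fun h1 h2 => absurd ⟨h1, h2⟩ hi⟩
    choose N hN H using hpair
    have hslice := ThinFilm.ae_integrable_slice (hρ q hq hqT)
    rw [ae_restrict_iff' measurableSet_Ioo, ae_iff] at hslice
    refine ⟨(⋃ i, N i) ∪ _, measure_union_null (measure_iUnion_null hN) hslice,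
      fun s t hs ht h0 hst htq => ?_⟩
    have hNs : ∀ i, s ∉ N i := fun i h => hs (Or.inl (Set.mem_iUnion_of_mem i h))
    have hNt : ∀ i, t ∉ N i := fun i h => ht (Or.inl (Set.mem_iUnion_of_mem i h))
    refine ThinFilm.apparentSupport_subset ?_ ?_ (fun c d hc hd j => ?_) fun c d hc hd j => ?_
    · by_contra hcon
      exact hs (Or.inr fun h => hcon (h ⟨h0, hst.trans htq⟩))
    · by_contra hcon
      exact ht (Or.inr fun h => hcon (h ⟨h0.trans hst, htq⟩))
    · exact (H (c, d, j) hc hd).2 s t (hNs _) (hNt _) h0 hst htq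
    · exact (H (c, d, j) hc hd).1 t (hNt _) (h0.trans hst) htq
  have hloc' : ∀ q : ℚ, ∃ N : Set ℝ, volume N = 0 ∧ (0 < (q : ℝ) → ((q : ℝ) : EReal) ≤ T →
      ∀ s t : ℝ, s ∉ N → t ∉ N → 0 < s → s < t → t < q →
        ThinFilm.apparentSupport a b ρ s ⊆ ThinFilm.apparentSupport a b ρ t) := by
    intro q
    by_cases hq : 0 < (q : ℝ) ∧ ((q : ℝ) : EReal) ≤ T
    · obtain ⟨N, hN, h⟩ := hloc q hq.1 hq.2
      exact ⟨N, hN, fun _ _ => h⟩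
    · exact ⟨∅, measure_empty, fun h1 h2 => absurd ⟨h1, h2⟩ hq⟩
  choose N hN H using hloc'
  refine ⟨⋃ q, N q, measure_iUnion_null hN, fun s t hs ht h0 hst htT => ?_⟩
  -- Each `t < T` lies below a rational horizon `q < T`, so countably many finite horizons suffice,
  -- also for infinite `T`.
  obtain ⟨q, htq, hqT⟩ := EReal.lt_iff_exists_rat_btwn.1 htT
  have htq' : t < q := EReal.coe_lt_coe_iff.1 htq
  exact H q ((h0.trans hst).trans htq') hqT.le s t
    (fun h => hs (Set.mem_iUnion_of_mem q h)) (fun h => ht (Set.mem_iUnion_of_mem q h)) h0 hst htq'
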